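/- **Proposition 4.1.** Let $T>0$, let $A:[0,T]\times\mathbb R^n\to\mathbb R^n$, $B:[0,T]\times\mathbb R^n\to\mathbb R^{n\times m}$, $Q:[0,T]\times\mathbb R^n\to\mathbb R$, $S:[0,T]\times\mathbb R^n\to\mathbb R^m$, $R:[0,T]\times\mathbb R^n\to\mathbb S^m$ (symmetric matrices), $G:\mathbb R^n\to\mathbb R$, and assume the following. (H1) $A,B$ are continuous and there are $L_A,L_B,\tilde L_B>0$ such that for all $t\in[0,T]$, $x,\bar x\in\mathbb R^n$, $u\in\mathbb R^m$: $|A(t,x)-A(t,\bar x)|\le L_A|x-\bar x|$, $|B(t,x)-B(t,\bar x)|\le\tilde L_B|x-\bar x|$ and $\langle[B(t,x)-B(t,\bar x)]^T(x-\bar x),u\rangle\le L_B|x-\bar x|^2$. (H2) $Q,S,R,G$ are continuous, and there are $L,Q_0,G_0,S_0,\rho_0>0$, $\varepsilon_0\in(0,1)$ and a continuous $\rho:\mathbb R^n\to[\rho_0,\infty)$ such that for all $(t,x)\in[0,T]\times\mathbb R^n$: $R(t,x)\ge\rho(x)I$; $(1-\varepsilon_0)Q(t,x)-\frac12S(t,x)^TR(t,x)^{-1}S(t,x)\ge-L$;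 $G(x)\ge-L$; $Q(t,x)\le Q_0(1+|x|^2)$; $G(x)\le G_0(1+|x|^2)$; $|S(t,x)|\le S_0(1+|x|)$; $|A(t,x)+B(t,x)R(t,x)^{-1}S(t,x)|\le L(1+|x|)$; $|B(t,x)R(t,x)^{-1}B(t,x)^T|\le L$. (H3) $(t,x)\mapsto(A,B,Q,S,R)(t,x)$ is twice continuously differentiable on $[0,T]\times\mathbb R^n$, and $G$ is twice continuously differentiable. Differential equations are understood in the sense of Carathéodory: solutions are absolutely continuous on $[t,T]$ and satisfy the equation for a.e. $s$. For $(t,x)\in[0,T]\times\mathbb R^n$ and $u\in\mathcal U[t,T]:=L^2(t,T;\mathbb R^m)$ let $X(\cdot;t,x,u)$ solve $\dot X(s)=A(s,X(s))+B(s,X(s))u(s)$, $X(t)=x$, and, with $X=X(\cdot;t,x,u)$, put $$J(t,x;u)=\int_t^T\Big[Q(s,X(s))+\langle S(s,X(s)),u(s)\rangle+\tfrac12\langle R(s,X(s))u(s),u(s)\rangle\Big]ds+G(X(T)).$$ Let $D_uJ(t,x;u)\in\mathcal U[t,T]$ be the gradient (Fréchet derivative, identified by Riesz representation) of $u\mapsto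 J(t,x;u)$ on the Hilbert space $\mathcal U[t,T]$, and let $D_{uu}J(t,x;u)$, a bounded linear operator on $\mathcal U[t,T]$, be the Fréchet derivative of $u\mapsto D_uJ(t,x;u)$. Let $B^j$ and $\tilde B^i$ be the $j$-th column of $B$ and the $i$-th column of $B^T$, let $R^j$ be the $j$-th column of $R$, and denote Jacobians and Hessians in $x$ by the subscripts $x$ and $xx$ (for a scalar function, the subscript $x$ gives a row vector). Then for every $(t,x)\in[0,T]\times\mathbb R^n$ and $u\in\mathcal U[t,T]$ the system $$\begin{cases}\dot X=A(s,X)+B(s,X)u,\\ \dot Y=-\big[A_x(s,X)+\sum_{j=1}^m u^jB^j_x(s,X)\big]^TY-Q_x(s,X)^T-S_x(s,X)^Tu-\frac12\sum_{j,k=1}^m u^ju^kR^{jk}_x(s,X)^T,\\ X(t)=x,\qquad Y(T)=G_x(X(T))^T,\end{cases}$$ on $[t,T]$ has a unique solution $(X,Y)$, the integrand of $J(t,x;u)$ is integrable, $J(t,x;\cdot)$ is differentiable at $u$, and for a.e. $s\in[t,T]$ $$[D_uJ(t,x;u)](s)=R(s,X(s))u(s)+S(s,X(s))+B(s,X(s))^TY(s).$$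 Further, $D_uJ(t,x;\cdot)$ is differentiable at $u$ and, for every $v\in\mathcal U[t,T]$, the system $$\begin{cases}\dot X_1(s)=\mathbf A(s)X_1(s)+B(s,X(s))v(s),\\ \dot Y_1(s)=-\mathbf A_1(s)X_1(s)-\mathbf A(s)^TY_1(s)-\mathbf C(s)^Tv(s),\\ X_1(t)=0,\qquad Y_1(T)=G_{xx}(X(T))X_1(T),\end{cases}$$ on $[t,T]$ has a unique solution $(X_1,Y_1)$, and for a.e. $s\in[t,T]$ $$[D_{uu}J(t,x;u)v](s)=R(s,X(s))v(s)+B(s,X(s))^TY_1(s)+\mathbf C(s)X_1(s),$$ where, with all coefficients evaluated at $(s,X(s))$ and $u,Y$ at $s$, $$\begin{aligned}\mathbf A(s)&=A_x+\sum_{j=1}^m u^jB^j_x,\\ \mathbf A_1(s)&=\sum_{i=1}^nY^iA^i_{xx}+Q_{xx}+\frac12\sum_{j,k=1}^m u^ju^kR^{jk}_{xx}+\sum_{j=1}^m u^j\Big[\sum_{i=1}^nY^iB^{ij}_{xx}+S^j_{xx}\Big],\\ \mathbf C(s)&=\sum_{j=1}^m u^jR^j_x+S_x+\sum_{i=1}^nY^i\tilde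 B^i_x.\end{aligned}$$ -/

import Mathlib

open MeasureTheory Set
open scoped InnerProduct InnerProductSpace Gradient

/-- Euclidean space `ℝᵏ` of column vectors. -/
abbrev Rn (k : ℕ) := EuclideanSpace ℝ (Fin k)

/-- The data of an affine-quadratic problem on the horizon `[0, T]`. Matrices are identified with the
linear maps they define in the standard bases, transposes with adjoints. Only the values at times in
`[0, T]` matter. -/
structure AQProblem (n m : ℕ) where
  T : ℝ
  A : ℝ → Rn n → Rn n
  B : ℝ → Rn n → (Rn m →L[ℝ] Rn n)
  Q : ℝ → Rn n → ℝ
  S : ℝ → Rn n → Rn m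
  R : ℝ → Rn n → (Rn m →L[ℝ] Rn m)
  G : Rn n → ℝ

/-- Controls on `[t, T]` with control set `U = ℝᵐ`: the Hilbert space `L²(t, T; ℝᵐ)`. -/
noncomputable abbrev Control (m : ℕ) (t T : ℝ) : Type := Lp (Rn m) 2 (volume.restrict (Icc t T))

/-- `X` is absolutely continuous on `[t, T]` with derivative `F` almost everywhere, in integral form.
With `F r` depending on `X r` this is an ordinary differential equation in the sense of
Carathéodory. -/
def SolvesODE {k : ℕ} (t T : ℝ) (X F : ℝ → Rn k) : Prop :=
  IntervalIntegrable F volume t T ∧ ∀ s ∈ Icc t T, X s = X t + ∫ r in t..s, F r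

/-- The `j`-th standard unit vector. -/
noncomputable def unitVec {k : ℕ} (j : Fin k) : Rn k := EuclideanSpace.single j 1

/-- The Hessian `f_xx(x)`, as a linear map. -/
noncomputable def hess {k : ℕ} (f : Rn k → ℝ) (x : Rn k) : Rn k →L[ℝ] Rn k :=
  fderiv ℝ (fun y => ∇ f y) x

namespace AQProblem

variable {n m : ℕ} (P : AQProblem n m)

/-- Assumptions on the state equation, for the control set `U = ℝᵐ`. -/
structure H1 : Prop where
  contA : ContinuousOn (fun p : ℝ × Rn n => P.A p.1 p.2) (Icc 0 P.T ×ˢ univ)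
  contB : ContinuousOn (fun p : ℝ × Rn n => P.B p.1 p.2) (Icc 0 P.T ×ˢ univ)
  lipA : ∃ LA > 0, ∀ t ∈ Icc 0 P.T, ∀ x y : Rn n, ‖P.A t x - P.A t y‖ ≤ LA * ‖x - y‖
  lipB : ∃ LB > 0, ∀ t ∈ Icc 0 P.T, ∀ x y : Rn n, ‖P.B t x - P.B t y‖ ≤ LB * ‖x - y‖
  monoB : ∃ LB > 0, ∀ t ∈ Icc 0 P.T, ∀ u : Rn m, ∀ x y : Rn n,
    ⟪((P.B t x - P.B t y)†) (x - y), u⟫_ℝ ≤ LB * ‖x - y‖ ^ 2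

/-- Assumptions on the cost functional. The operator `R` is invertible by the lower bound, so that
`ContinuousLinearMap.inverse` is its inverse. -/
structure H2 : Prop where
  contQ : ContinuousOn (fun p : ℝ × Rn n => P.Q p.1 p.2) (Icc 0 P.T ×ˢ univ)
  contS : ContinuousOn (fun p : ℝ × Rn n => P.S p.1 p.2) (Icc 0 P.T ×ˢ univ)
  contR : ContinuousOn (fun p : ℝ × Rn n => P.R p.1 p.2) (Icc 0 P.T ×ˢ univ)
  contG : Continuous P.G
  symmR : ∀ t ∈ Icc 0 P.T, ∀ x, IsSelfAdjoint (P.R t x)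
  bounds : ∃ L > 0, ∃ Q₀ > 0, ∃ G₀ > 0, ∃ S₀ > 0, ∃ ε₀ ∈ Ioo (0 : ℝ) 1, ∃ ρ₀ > 0,
    ∃ ρ : Rn n → ℝ, Continuous ρ ∧ (∀ x, ρ₀ ≤ ρ x) ∧
    ∀ t ∈ Icc 0 P.T, ∀ x : Rn n,
      (∀ w : Rn m, ρ x * ‖w‖ ^ 2 ≤ ⟪P.R t x w, w⟫_ℝ) ∧
      -L ≤ (1 - ε₀) * P.Q t x - 1 / 2 * ⟪P.S t x, (P.R t x).inverse (P.S t x)⟫_ℝ ∧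
      -L ≤ P.G x ∧
      P.Q t x ≤ Q₀ * (1 + ‖x‖ ^ 2) ∧
      P.G x ≤ G₀ * (1 + ‖x‖ ^ 2) ∧
      ‖P.S t x‖ ≤ S₀ * (1 + ‖x‖) ∧
      ‖P.A t x + P.B t x ((P.R t x).inverse (P.S t x))‖ ≤ L * (1 + ‖x‖) ∧
      ‖P.B t x ∘L (P.R t x).inverse ∘L (P.B t x)†‖ ≤ L

/-- All coefficients are twice continuously differentiable (one-sided at times `0` and `T`). -/
structure H3 : Prop where
  smoothA : ContDiffOn ℝ 2 (fun p : ℝ × Rn n => P.A p.1 p.2) (Icc 0 P.T ×ˢ univ)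
  smoothB : ContDiffOn ℝ 2 (fun p : ℝ × Rn n => P.B p.1 p.2) (Icc 0 P.T ×ˢ univ)
  smoothQ : ContDiffOn ℝ 2 (fun p : ℝ × Rn n => P.Q p.1 p.2) (Icc 0 P.T ×ˢ univ)
  smoothS : ContDiffOn ℝ 2 (fun p : ℝ × Rn n => P.S p.1 p.2) (Icc 0 P.T ×ˢ univ)
  smoothR : ContDiffOn ℝ 2 (fun p : ℝ × Rn n => P.R p.1 p.2) (Icc 0 P.T ×ˢ univ)
  smoothG : ContDiff ℝ 2 P.G

/-- The `j`-th column of the matrix `B(s, x)`. -/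
noncomputable def Bcol (j : Fin m) (s : ℝ) (x : Rn n) : Rn n := P.B s x (unitVec j)

/-- The `i`-th row of the matrix `B(s, x)`, as a column vector in `ℝᵐ`. -/
noncomputable def Brow (i : Fin n) (s : ℝ) (x : Rn n) : Rn m := ((P.B s x)†) (unitVec i)

/-- The `j`-th column of the matrix `R(s, x)`. -/
noncomputable def Rcol (j : Fin m) (s : ℝ) (x : Rn n) : Rn m := P.R s x (unitVec j)

/-- The `(j, k)` entry of the matrix `R(s, x)`. -/
noncomputable def Rent (j k : Fin m) (s : ℝ) (x : Rn n) : ℝ := P.R s x (unitVec k) j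

/-- `X` solves the state equation `X' = A(s, X) + B(s, X) u(s)`, `X(t) = x`, on `[t, T]`. -/
def IsState (t : ℝ) (x : Rn n) (u : Control m t P.T) (X : ℝ → Rn n) : Prop :=
  SolvesODE t P.T X (fun s => P.A s (X s) + P.B s (X s) (u s)) ∧ X t = x

open Classical in
/-- The state trajectory `X(·; t, x, u(·))` (zero if the state equation has no solution). -/
noncomputable def state (t : ℝ) (x : Rn n) (u : Control m t P.T) : ℝ → Rn n :=
  if h : ∃ X, P.IsState t x u X then h.choose else 0

/-- The running cost along a trajectory `X` with control values `u`. -/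
noncomputable def runningCost (u : ℝ → Rn m) (X : ℝ → Rn n) (s : ℝ) : ℝ :=
  P.Q s (X s) + ⟪P.S s (X s), u s⟫_ℝ + 1 / 2 * ⟪P.R s (X s) (u s), u s⟫_ℝ

/-- The cost functional `u(·) ↦ J(t, x; u(·))`. -/
noncomputable def J (t : ℝ) (x : Rn n) (u : Control m t P.T) : ℝ :=
  (∫ s in t..P.T, P.runningCost u (P.state t x u) s) + P.G (P.state t x u P.T)

/-- The first derivative `D_u J(t, x; u(·))`, an element of `L²(t, T; ℝᵐ)` through the Riesz
representation. -/
noncomputable def DuJ (t : ℝ) (x : Rn n) (u : Control m t P.T) : Control m t P.T :=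
  ∇ (P.J t x) u

/-- The second derivative `D_uu J(t, x; u(·))`, a bounded linear operator on `L²(t, T; ℝᵐ)`. -/
noncomputable def DuuJ (t : ℝ) (x : Rn n) (u : Control m t P.T) :
    Control m t P.T →L[ℝ] Control m t P.T :=
  fderiv ℝ (P.DuJ t x) u

/-- The coefficient `𝐀(s)`. -/
noncomputable def coefA (u : ℝ → Rn m) (X : ℝ → Rn n) (s : ℝ) : Rn n →L[ℝ] Rn n :=
  fderiv ℝ (P.A s) (X s) + ∑ j, u s j • fderiv ℝ (P.Bcol j s) (X s)

/-- The coefficient `𝐀₁(s)`. -/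
noncomputable def coefA₁ (u : ℝ → Rn m) (X Y : ℝ → Rn n) (s : ℝ) : Rn n →L[ℝ] Rn n :=
  ∑ i, Y s i • hess (fun y => P.A s y i) (X s) + hess (P.Q s) (X s)
    + (1 / 2 : ℝ) • ∑ j, ∑ k, (u s j * u s k) • hess (P.Rent j k s) (X s)
    + ∑ j, u s j • (∑ i, Y s i • hess (fun y => P.Bcol j s y i) (X s)
        + hess (fun y => P.S s y j) (X s))

/-- The coefficient `𝐂(s)`. -/
noncomputable def coefC (u : ℝ → Rn m) (X Y : ℝ → Rn n) (s : ℝ) : Rn n →L[ℝ] Rn m :=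
  ∑ j, u s j • fderiv ℝ (P.Rcol j s) (X s) + fderiv ℝ (P.S s) (X s)
    + ∑ i, Y s i • fderiv ℝ (P.Brow i s) (X s)

/-- `(X, Y)` solves the decoupled forward-backward system (state and adjoint equation). -/
structure IsStateAdjoint (t : ℝ) (x : Rn n) (u : Control m t P.T) (X Y : ℝ → Rn n) : Prop where
  state : P.IsState t x u X
  adjoint : SolvesODE t P.T Y (fun s =>
    -((fderiv ℝ (P.A s) (X s) + ∑ j, u s j • fderiv ℝ (P.Bcol j s) (X s))†) (Y s)
      - ∇ (P.Q s) (X s) - ((fderiv ℝ (P.S s) (X s))†) (u s)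
      - (1 / 2 : ℝ) • ∑ j, ∑ k, (u s j * u s k) • ∇ (P.Rent j k s) (X s))
  terminal : Y P.T = ∇ P.G (X P.T)

/-- `(X₁, Y₁)` solves the linearized forward-backward system in the direction `v`. -/
structure IsLinearized (t : ℝ) (u : Control m t P.T) (X Y : ℝ → Rn n) (v : Control m t P.T)
    (X₁ Y₁ : ℝ → Rn n) : Prop where
  forward : SolvesODE t P.T X₁ (fun s => P.coefA u X s (X₁ s) + P.B s (X s) (v s))
  backward : SolvesODE t P.T Y₁ (fun s =>
    -P.coefA₁ u X Y s (X₁ s) - ((P.coefA u X s)†) (Y₁ s) - ((P.coefC u X Y s)†) (v s))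
  initial : X₁ t = 0
  terminal : Y₁ P.T = hess P.G (X P.T) (X₁ P.T)

end AQProblem

/-!
The control enters the state and costate equations only through `q = (1, u, u ⊗ u)`, which lies in
`L¹` and depends smoothly on `u ∈ L²`, and it enters linearly. Both equations are Volterra
fixed-point equations in `C([t, T])`, contracting in an exponentially weighted sup norm, so the
implicit function theorem gives the solutions and their differentiability in `u`; the derivatives
solve the linearized equations. Integration by parts against the costate `Y` turns the derivative of
the cost in the direction `v` into `∫ H_u v`, where `H` is the Hamiltonian; this is the formula
`R u + S + Bᵀ Y` for the gradient. Differentiating that formula in `u` gives the second derivative,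
and `𝐀`, `𝐂`, `𝐀₁` are the mixed and pure second derivatives of `H`.
-/

namespace CurveSpace

set_option maxSynthPendingDepth 3

/-! ### Curves and superposition operators -/

section Superposition

variable {K E F : Type*} [TopologicalSpace K] [TopologicalSpace E] [TopologicalSpace F]

/-- The superposition (Nemytskii) operator `X ↦ (s ↦ g (s, X s))` of a coefficient `g`. -/
def superposition (g : C(K × E, F)) (X : C(K, E)) : C(K, F) :=
  g.comp ((ContinuousMap.id K).prodMk X)

@[simp] lemma superposition_apply (g : C(K × E, F)) (X : C(K, E)) (s : K) :
    superposition g X s = g (s, X s) := rfl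

lemma continuous_superposition [LocallyCompactPair K E] (g : C(K × E, F)) :
    Continuous (superposition g) :=
  (ContinuousMap.continuous_postcomp g).comp
    (ContinuousMap.continuous_of_continuous_uncurry _
      (continuous_snd.prodMk (continuous_eval.comp continuous_id)))

end Superposition

section Curves

variable {K E F : Type*} [TopologicalSpace K] [NormedAddCommGroup E] [NormedSpace ℝ E]
  [NormedAddCommGroup F] [NormedSpace ℝ F]

/-- The pair of two curves, as a curve in the product. -/
noncomputable def curvePair : C(K, E) × C(K, F) →L[ℝ] C(K, E × F) :=
  ((ContinuousLinearMap.inl ℝ E F).compLeftContinuous ℝ K).coprod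
    ((ContinuousLinearMap.inr ℝ E F).compLeftContinuous ℝ K)

@[simp] lemma curvePair_apply (Z : C(K, E) × C(K, F)) (s : K) :
    curvePair Z s = (Z.1 s, Z.2 s) := by
  simp [curvePair]

/-- Pointwise composition of two curves of operators. -/
noncomputable def compCurve {G : Type*} [NormedAddCommGroup G] [NormedSpace ℝ G]
    (N : C(K, F →L[ℝ] G)) (M : C(K, E →L[ℝ] F)) : C(K, E →L[ℝ] G) :=
  ⟨fun s => N s ∘L M s, by fun_prop⟩

@[simp] lemma compCurve_apply {G : Type*} [NormedAddCommGroup G] [NormedSpace ℝ G]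
    (N : C(K, F →L[ℝ] G)) (M : C(K, E →L[ℝ] F)) (s : K) : compCurve N M s = N s ∘L M s := rfl

end Curves

section CompactDomain

variable {K E F : Type*} [TopologicalSpace K] [CompactSpace K]
  [NormedAddCommGroup E] [NormedSpace ℝ E] [NormedAddCommGroup F] [NormedSpace ℝ F]

/-- Pointwise application of a curve of operators to a curve. -/
noncomputable def pointwiseApply (M : C(K, E →L[ℝ] F)) : C(K, E) →L[ℝ] C(K, F) :=
  LinearMap.mkContinuous
    { toFun := fun X => ⟨fun s => M s (X s), by fun_prop⟩
      map_add' := fun X Y => ContinuousMap.ext fun s => map_add (M s) (X s) (Y s)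
      map_smul' := fun c X => ContinuousMap.ext fun s => map_smul (M s) c (X s) }
    ‖M‖ fun X => (ContinuousMap.norm_le _ (by positivity)).2 fun s =>
      (M s).le_of_opNorm_le_of_le (M.norm_coe_le_norm s) (X.norm_coe_le_norm s)

@[simp] lemma pointwiseApply_apply (M : C(K, E →L[ℝ] F)) (X : C(K, E)) (s : K) :
    pointwiseApply M X s = M s (X s) := rfl

/-- The embedding of the state space into the space of curves. -/
noncomputable def constCurve : E →L[ℝ] C(K, E) :=
  LinearMap.mkContinuous
    { toFun := ContinuousMap.const K
      map_add' := fun _ _ => rfl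
      map_smul' := fun _ _ => rfl }
    1 fun x => by
      simpa only [one_mul] using (ContinuousMap.norm_le _ (norm_nonneg x)).2 fun _ => le_rfl

@[simp] lemma constCurve_apply (x : E) (s : K) : constCurve x s = x := rfl

lemma exists_ball_norm_sub_le {G : Type*} [NormedAddCommGroup G] (g : C(K × E, G)) (X : C(K, E))
    {ε : ℝ} (hε : 0 < ε) :
    ∃ δ > 0, ∀ s, ∀ x ∈ Metric.ball (X s) δ, ‖g (s, x) - g (s, X s)‖ ≤ ε := by
  obtain ⟨δ, hδ, hclose⟩ :=
    Metric.continuousAt_iff.1 ((continuous_superposition g).continuousAt (x := X)) ε hε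
  refine ⟨δ, hδ, fun s x hx => ?_⟩
  -- the translate of `X` through `x` is uniformly as close to `X` as `x` is to `X s`
  have htranslate : dist (X + constCurve (x - X s)) X < δ := by
    rw [dist_eq_norm, add_sub_cancel_left]
    refine lt_of_le_of_lt ((ContinuousMap.norm_le _ (norm_nonneg (x - X s))).2 fun _ => le_rfl) ?_
    rwa [← dist_eq_norm]
  simpa [dist_eq_norm] using
    (ContinuousMap.dist_apply_le_dist s).trans (hclose htranslate).le

lemma hasStrictFDerivAt_superposition (g : C(K × E, F)) (g' : C(K × E, E →L[ℝ] F))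
    (hg : ∀ s x, HasFDerivAt (fun y => g (s, y)) (g' (s, x)) x) (X : C(K, E)) :
    HasStrictFDerivAt (superposition g) (pointwiseApply (superposition g' X)) X := by
  refine .of_isLittleO (Asymptotics.isLittleO_iff.2 fun ε hε => ?_)
  obtain ⟨δ, hδ, hg'⟩ := exists_ball_norm_sub_le g' X hε
  filter_upwards [prod_mem_nhds (Metric.ball_mem_nhds X hδ) (Metric.ball_mem_nhds X hδ)]
    with ⟨Y, Z⟩ ⟨hY, hZ⟩
  refine (ContinuousMap.norm_le _ (by positivity)).2 fun s => ?_
  have hball : ∀ W ∈ Metric.ball X δ, W s ∈ Metric.ball (X s) δ := fun W hW =>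
    lt_of_le_of_lt (ContinuousMap.dist_apply_le_dist s) hW
  calc ‖g (s, Y s) - g (s, Z s) - g' (s, X s) (Y s - Z s)‖
      ≤ ε * ‖Y s - Z s‖ :=
        (convex_ball (X s) δ).norm_image_sub_le_of_norm_hasFDerivWithin_le'
          (f := fun y => g (s, y)) (fun x _ => (hg s x).hasFDerivWithinAt) (hg' s)
          (hball _ hZ) (hball _ hY)
    _ ≤ ε * ‖Y - Z‖ := by gcongr; exact (Y - Z).norm_coe_le_norm s

end CompactDomain

section Extension

variable {t T : ℝ} [hT : Fact (t ≤ T)] {E : Type*}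

/-- Extension of a curve on `[t, T]` to `ℝ`, constant on either side of `[t, T]`. -/
noncomputable def extend [TopologicalSpace E] (X : C(Icc t T, E)) : ℝ → E := IccExtend hT.out X

lemma continuous_extend [TopologicalSpace E] (X : C(Icc t T, E)) : Continuous (extend X) :=
  X.continuous.Icc_extend'

lemma extend_of_mem [TopologicalSpace E] (X : C(Icc t T, E)) {s : ℝ} (hs : s ∈ Icc t T) :
    extend X s = X ⟨s, hs⟩ :=
  IccExtend_of_mem _ _ hs

@[simp] lemma extend_coe [TopologicalSpace E] (X : C(Icc t T, E)) (s : Icc t T) :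
    extend X s = X s :=
  extend_of_mem X s.2

lemma extend_curvePair {F : Type*} [NormedAddCommGroup E] [NormedSpace ℝ E]
    [NormedAddCommGroup F] [NormedSpace ℝ F] (Z : C(Icc t T, E) × C(Icc t T, F)) (s : ℝ) :
    extend (curvePair Z) s = (extend Z.1 s, extend Z.2 s) :=
  curvePair_apply Z _

lemma norm_extend_le [NormedAddCommGroup E] (X : C(Icc t T, E)) (s : ℝ) : ‖extend X s‖ ≤ ‖X‖ :=
  X.norm_coe_le_norm _

end Extension

section Integration

/-- The space `Lᵖ(t, T; E)`. -/
abbrev LpOn (p : ENNReal) (t T : ℝ) (E : Type*) [NormedAddCommGroup E] : Type _ :=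
  Lp E p (volume.restrict (Icc t T))

variable {t T : ℝ} {E F : Type*} [NormedAddCommGroup E]

lemma intervalIntegrable_of_integrable {f : ℝ → E}
    (hf : Integrable f (volume.restrict (Icc t T))) (a s : Icc t T) :
    IntervalIntegrable f volume a s :=
  (IntegrableOn.mono_set hf (uIcc_subset_Icc a.2 s.2)).intervalIntegrable

variable [NormedSpace ℝ E] [NormedAddCommGroup F] [NormedSpace ℝ F]

/-- The class of a curve in `Lᵖ(t, T; E)`. -/
noncomputable def curveToLp [hT : Fact (t ≤ T)] (p : ENNReal) [Fact (1 ≤ p)] :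
    C(Icc t T, E) →L[ℝ] LpOn p t T E :=
  BoundedContinuousFunction.toLp p (volume.restrict (Icc t T)) ℝ ∘L
    LinearMap.mkContinuous
      { toFun := fun X => BoundedContinuousFunction.ofNormedAddCommGroup (extend X)
          (continuous_extend X) ‖X‖ (norm_extend_le X)
        map_add' := fun _ _ => rfl
        map_smul' := fun _ _ => rfl }
      1 fun X => by
        simpa only [one_mul] using
          (BoundedContinuousFunction.norm_le (norm_nonneg X)).2 (norm_extend_le X)

lemma coeFn_curveToLp [Fact (t ≤ T)] (p : ENNReal) [Fact (1 ≤ p)] (X : C(Icc t T, E)) :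
    curveToLp p X =ᵐ[volume.restrict (Icc t T)] extend X :=
  BoundedContinuousFunction.coeFn_toLp p (volume.restrict (Icc t T)) ℝ _

/-- Pointwise application of a curve of operators to an `Lᵖ` function. -/
noncomputable def applyLp [Fact (t ≤ T)] (p : ENNReal) [Fact (1 ≤ p)] :
    C(Icc t T, E →L[ℝ] F) →L[ℝ] LpOn p t T E →L[ℝ] LpOn p t T F :=
  (ContinuousLinearMap.id ℝ (E →L[ℝ] F)).holderL (volume.restrict (Icc t T)) ⊤ p p ∘L
    curveToLp ⊤

lemma coeFn_applyLp [Fact (t ≤ T)] (p : ENNReal) [Fact (1 ≤ p)] (M : C(Icc t T, E →L[ℝ] F))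
    (φ : LpOn p t T E) :
    applyLp p M φ =ᵐ[volume.restrict (Icc t T)] fun s => extend M s (φ s) := by
  filter_upwards [(ContinuousLinearMap.id ℝ (E →L[ℝ] F)).coeFn_holder (r := p) (curveToLp ⊤ M) φ,
    coeFn_curveToLp ⊤ M] with s happly hM
  rw [← hM]
  exact happly

lemma applyLp_applyLp [Fact (t ≤ T)] {G : Type*} [NormedAddCommGroup G] [NormedSpace ℝ G]
    (p : ENNReal) [Fact (1 ≤ p)] (N : C(Icc t T, F →L[ℝ] G)) (M : C(Icc t T, E →L[ℝ] F))
    (φ : LpOn p t T E) : applyLp p N (applyLp p M φ) = applyLp p (compCurve N M) φ := by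
  refine Lp.ext ?_
  filter_upwards [coeFn_applyLp p N (applyLp p M φ), coeFn_applyLp p M φ,
    coeFn_applyLp p (compCurve N M) φ] with s hN hM hNM
  rw [hN, hM, hNM]
  rfl

lemma intervalIntegral_congr_of_ae {f g : ℝ → E} (h : f =ᵐ[volume.restrict (Icc t T)] g)
    (a s : Icc t T) : ∫ r in a..s, f r = ∫ r in a..s, g r :=
  intervalIntegral.integral_congr_ae_restrict
    (ae_restrict_of_ae_restrict_of_subset
      (uIoc_subset_uIcc.trans (uIcc_subset_Icc a.2 s.2)) h)

variable [hT : Fact (t ≤ T)]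

lemma continuous_intervalIntegral (a : Icc t T) {f : ℝ → E}
    (hf : Integrable f (volume.restrict (Icc t T))) :
    Continuous fun s : Icc t T => ∫ r in a..s, f r := by
  have h : ContinuousOn (fun s => ∫ r in (a : ℝ)..s, f r) (uIcc t T) :=
    intervalIntegral.continuousOn_primitive_interval'
      (intervalIntegrable_of_integrable hf ⟨t, left_mem_Icc.2 hT.out⟩
        ⟨T, right_mem_Icc.2 hT.out⟩)
      (by rw [uIcc_of_le hT.out]; exact a.2)
  rw [uIcc_of_le hT.out] at h
  exact continuousOn_iff_continuous_domRestrict.1 h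

/-- The primitive that vanishes at `a` of an integrable function, as a curve. -/
noncomputable def primitive (a : Icc t T) : LpOn 1 t T E →L[ℝ] C(Icc t T, E) :=
  LinearMap.mkContinuous
    { toFun := fun φ => ⟨fun s => ∫ r in a..s, φ r,
        continuous_intervalIntegral a (L1.integrable_coeFn φ)⟩
      map_add' := fun φ ψ => by
        ext s
        exact (intervalIntegral_congr_of_ae (Lp.coeFn_add φ ψ) a s).trans
          (intervalIntegral.integral_add
            (intervalIntegrable_of_integrable (L1.integrable_coeFn φ) a s)
            (intervalIntegrable_of_integrable (L1.integrable_coeFn ψ) a s))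
      map_smul' := fun c φ => by
        ext s
        exact (intervalIntegral_congr_of_ae (Lp.coeFn_smul c φ) a s).trans
          (intervalIntegral.integral_smul c _) }
    1 fun φ => (ContinuousMap.norm_le _ (by positivity)).2 fun s => by
      rw [one_mul, L1.norm_eq_integral_norm]
      exact intervalIntegral.norm_integral_le_integral_norm_uIoc.trans
        (setIntegral_mono_set (L1.integrable_coeFn φ).norm (.of_forall fun _ => norm_nonneg _)
          (uIoc_subset_uIcc.trans (uIcc_subset_Icc a.2 s.2)).eventuallyLE)

lemma primitive_apply (a : Icc t T) (φ : LpOn 1 t T E) (s : Icc t T) :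
    primitive a φ s = ∫ r in a..s, φ r := rfl

end Integration

/-! ### Volterra equations -/

section Weight

lemma exists_integral_sub_min_lt {α : Type*} [MeasurableSpace α] {μ : Measure α} {ℓ : α → ℝ}
    [IsFiniteMeasure μ] (hℓ : Integrable ℓ μ) (hℓ0 : ∀ r, 0 ≤ ℓ r) {ε : ℝ} (hε : 0 < ε) :
    ∃ N : ℕ, ∫ r, (ℓ r - min (ℓ r) N) ∂μ < ε := by
  have hlim : Filter.Tendsto (fun N : ℕ => ∫ r, (ℓ r - min (ℓ r) N) ∂μ) Filter.atTop
      (nhds (∫ _, (0 : ℝ) ∂μ)) := by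
    refine tendsto_integral_of_dominated_convergence ℓ
      (fun N => (hℓ.sub (hℓ.inf (integrable_const (N : ℝ)))).aestronglyMeasurable) hℓ
      (fun N => .of_forall fun r => ?_) (.of_forall fun r => ?_)
    · rw [Real.norm_of_nonneg (sub_nonneg.2 (min_le_left _ _))]
      exact sub_le_self _ (le_min (hℓ0 r) N.cast_nonneg)
    · refine tendsto_const_nhds.congr' ?_
      filter_upwards [Filter.eventually_ge_atTop ⌈ℓ r⌉₊] with N hN
      rw [min_eq_left (Nat.ceil_le.1 hN), sub_self]
  rw [integral_zero] at hlim
  exact (hlim.eventually_lt_const hε).exists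

lemma integral_exp_neg_mul_abs_sub {k : ℝ} (hk : 0 < k) (s : ℝ) :
    ∫ r, Real.exp (-(k * |s - r|)) = 2 / k := by
  have hscale : ∀ r, Real.exp (-(k * |r|)) = (fun y => Real.exp (-|y|)) (k * r) := fun r => by
    simp only [abs_mul, abs_of_pos hk]
  calc ∫ r, Real.exp (-(k * |s - r|))
      = ∫ r, Real.exp (-(k * |r|)) :=
        integral_sub_left_eq_self (fun r => Real.exp (-(k * |r|))) volume s
    _ = k⁻¹ * ∫ y, Real.exp (-|y|) := by
        simp_rw [hscale]
        rw [Measure.integral_comp_mul_left (fun y => Real.exp (-|y|)), abs_of_pos (inv_pos.2 hk),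
          smul_eq_mul]
    _ = 2 / k := by
        rw [integral_comp_abs (f := fun y => Real.exp (-y)), integral_exp_neg_Ioi_zero]
        ring

lemma exp_neg_mul_abs_le_one {k : ℝ} (hk : 0 < k) (r : ℝ) : Real.exp (-(k * |r|)) ≤ 1 :=
  Real.exp_le_one_iff.2 (neg_nonpos.2 (by positivity))

lemma exists_exp_weight {t T : ℝ} {ℓ : ℝ → ℝ} (hℓ : Integrable ℓ (volume.restrict (Icc t T)))
    (hℓ0 : ∀ r, 0 ≤ ℓ r) :
    ∃ k > 0, ∀ s : ℝ, ∫ r in Icc t T, ℓ r * Real.exp (-(k * |s - r|)) ≤ 1 / 2 := by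
  obtain ⟨N, hN⟩ := exists_integral_sub_min_lt hℓ hℓ0 (show (0 : ℝ) < 1 / 4 by norm_num)
  have htail : Integrable (fun r => ℓ r - min (ℓ r) N) (volume.restrict (Icc t T)) :=
    hℓ.sub (hℓ.inf (integrable_const _))
  obtain ⟨k, hk, hNk⟩ : ∃ k > 0, (N : ℝ) * (2 / k) ≤ 1 / 4 := by
    refine ⟨8 * (N + 1), by positivity, ?_⟩
    rw [mul_div_assoc', div_le_iff₀ (by positivity)]
    linarith
  refine ⟨k, hk, fun s => ?_⟩
  have hexp : Integrable (fun r => Real.exp (-(k * |s - r|))) := by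
    refine .of_integral_ne_zero ?_
    rw [integral_exp_neg_mul_abs_sub hk]
    positivity
  calc ∫ r in Icc t T, ℓ r * Real.exp (-(k * |s - r|))
      ≤ ∫ r in Icc t T, ((ℓ r - min (ℓ r) N) + N * Real.exp (-(k * |s - r|))) := by
        refine integral_mono_of_nonneg (.of_forall fun r => by have := hℓ0 r; positivity)
          (htail.add (hexp.integrableOn.const_mul _)) (.of_forall fun r => ?_)
        dsimp only
        nlinarith [min_le_left (ℓ r) N, min_le_right (ℓ r) N, Real.exp_pos (-(k * |s - r|)),
          exp_neg_mul_abs_le_one hk (s - r)]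
    _ = (∫ r in Icc t T, (ℓ r - min (ℓ r) N)) + N * ∫ r in Icc t T, Real.exp (-(k * |s - r|)) := by
        rw [integral_add htail (hexp.integrableOn.const_mul _), integral_const_mul]
    _ ≤ 1 / 4 + N * (2 / k) := by
        gcongr
        rw [← integral_exp_neg_mul_abs_sub hk s]
        exact setIntegral_le_integral hexp (.of_forall fun r => (Real.exp_pos _).le)
    _ ≤ 1 / 2 := by linarith

end Weight

section Volterra

variable {t T : ℝ}

/-- The curve `s ↦ exp (k * |a - s|)`. Dividing by it, for large `k`, turns Volterra operators based
at `a` into contractions. -/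
noncomputable def expWeight (k : ℝ) (a : Icc t T) : C(Icc t T, ℝ) :=
  ⟨fun s => Real.exp (k * |(a : ℝ) - s|), by fun_prop⟩

lemma expWeight_apply (k : ℝ) (a s : Icc t T) :
    expWeight k a s = Real.exp (k * |(a : ℝ) - s|) := rfl

lemma norm_expWeight (k : ℝ) (a s : Icc t T) : ‖expWeight k a s‖ = expWeight k a s :=
  Real.norm_of_nonneg (Real.exp_pos _).le

lemma expWeight_neg_mul (k : ℝ) (a : Icc t T) : expWeight (-k) a * expWeight k a = 1 := by
  ext s
  simp [expWeight_apply, ← Real.exp_add]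

lemma expWeight_neg_mul_expWeight (k : ℝ) {a s r : Icc t T} (hr : (r : ℝ) ∈ uIcc (a : ℝ) s) :
    expWeight (-k) a s * expWeight k a r = Real.exp (-(k * |(s : ℝ) - r|)) := by
  have habs : |(a : ℝ) - s| = |(a : ℝ) - r| + |(s : ℝ) - r| := by
    rw [← segment_eq_uIcc, mem_segment_iff_wbtw, ← dist_add_dist_eq_iff] at hr
    simpa only [Real.dist_eq, abs_sub_comm (r : ℝ) s] using hr.symm
  rw [expWeight_apply, expWeight_apply, ← Real.exp_add, habs]
  congr 1
  ring

variable [hT : Fact (t ≤ T)] {E V : Type*} [NormedAddCommGroup E] [NormedSpace ℝ E]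
  [NormedAddCommGroup V] [NormedSpace ℝ V]

lemma integral_uIoc_mul_weighted_le {ℓ : ℝ → ℝ}
    (hℓ : Integrable ℓ (volume.restrict (Icc t T))) (hℓ0 : ∀ r, 0 ≤ ℓ r) {k : ℝ} (hk : 0 < k)
    (a s : Icc t T) (X : C(Icc t T, E)) :
    expWeight (-k) a s * ∫ r in uIoc (a : ℝ) s, ℓ r * ‖extend (expWeight k a • X) r‖ ≤
      (∫ r in Icc t T, ℓ r * Real.exp (-(k * |(s : ℝ) - r|))) * ‖X‖ := by
  have hsub : uIoc (a : ℝ) s ⊆ Icc t T := uIoc_subset_uIcc.trans (uIcc_subset_Icc a.2 s.2)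
  have hint : Integrable (fun r => ℓ r * Real.exp (-(k * |(s : ℝ) - r|)) * ‖X‖)
      (volume.restrict (Icc t T)) := by
    refine (hℓ.mul_bdd (c := 1) (by fun_prop) (.of_forall fun r => ?_)).mul_const _
    rw [Real.norm_of_nonneg (Real.exp_pos _).le]
    exact exp_neg_mul_abs_le_one hk _
  rw [← integral_const_mul, ← integral_mul_const]
  refine (integral_mono_of_nonneg (.of_forall fun r => ?_) (IntegrableOn.mono_set hint hsub)
    ?_).trans (setIntegral_mono_set hint (.of_forall fun r => ?_) hsub.eventuallyLE)
  · have := hℓ0 r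
    exact mul_nonneg (Real.exp_pos _).le (by positivity)
  · filter_upwards [ae_restrict_mem measurableSet_uIoc] with r hr
    have hr' : r ∈ Icc t T := hsub hr
    calc expWeight (-k) a s * (ℓ r * ‖extend (expWeight k a • X) r‖)
        = ℓ r * (expWeight (-k) a s * expWeight k a ⟨r, hr'⟩) * ‖X ⟨r, hr'⟩‖ := by
          rw [extend_of_mem _ hr', ContinuousMap.smul_apply', norm_smul, norm_expWeight]
          ring
      _ ≤ ℓ r * Real.exp (-(k * |(s : ℝ) - r|)) * ‖X‖ := by
          rw [expWeight_neg_mul_expWeight k (r := ⟨r, hr'⟩) (uIoc_subset_uIcc hr)]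
          have := hℓ0 r
          gcongr
          exact X.norm_coe_le_norm _
  · have := hℓ0 r
    dsimp only [Pi.zero_apply]
    positivity

lemma existsUnique_eq_of_norm_sub_le_integral [CompleteSpace E] (a : Icc t T) {ℓ : ℝ → ℝ}
    (hℓ : Integrable ℓ (volume.restrict (Icc t T))) (hℓ0 : ∀ r, 0 ≤ ℓ r)
    (Φ : C(Icc t T, E) → C(Icc t T, E))
    (hΦ : ∀ X Y s, ‖Φ X s - Φ Y s‖ ≤ ∫ r in uIoc (a : ℝ) s, ℓ r * ‖extend (X - Y) r‖) :
    ∃! X, X = Φ X := by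
  obtain ⟨k, hk, hkℓ⟩ := exists_exp_weight hℓ hℓ0
  set w := expWeight k a
  set w' := expWeight (-k) a
  have hww' : ∀ X : C(Icc t T, E), w • w' • X = X := fun X => by
    rw [smul_smul, mul_comm, expWeight_neg_mul, one_smul]
  have hcontr : ContractingWith (1 / 2) fun Z => w' • Φ (w • Z) := by
    refine ⟨by rw [← NNReal.coe_lt_coe]; norm_num, LipschitzWith.of_dist_le_mul fun X Y => ?_⟩
    rw [dist_eq_norm, dist_eq_norm, ← smul_sub]
    refine (ContinuousMap.norm_le _ (by positivity)).2 fun s => ?_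
    calc ‖(w' • (Φ (w • X) - Φ (w • Y))) s‖
        = w' s * ‖Φ (w • X) s - Φ (w • Y) s‖ := by
          rw [ContinuousMap.smul_apply', norm_smul, norm_expWeight]
          rfl
      _ ≤ w' s * ∫ r in uIoc (a : ℝ) s, ℓ r * ‖extend (w • (X - Y)) r‖ := by
          rw [smul_sub]
          exact mul_le_mul_of_nonneg_left (hΦ _ _ s) (Real.exp_pos _).le
      _ ≤ (∫ r in Icc t T, ℓ r * Real.exp (-(k * |(s : ℝ) - r|))) * ‖X - Y‖ :=
          integral_uIoc_mul_weighted_le hℓ hℓ0 hk a s (X - Y)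
      _ ≤ 1 / 2 * ‖X - Y‖ := by gcongr; exact hkℓ s
      _ = ((1 / 2 : NNReal) : ℝ) * ‖X - Y‖ := by norm_num
  refine ⟨w • hcontr.fixedPoint, ?_, fun X hX => ?_⟩
  · have hfix : w' • Φ (w • hcontr.fixedPoint) = hcontr.fixedPoint := hcontr.fixedPoint_isFixedPt
    exact (congrArg (w • ·) hfix).symm.trans (hww' _)
  · have hfix : w' • Φ (w • w' • X) = w' • X := by rw [hww', ← hX]
    rw [← hcontr.fixedPoint_unique hfix, hww']

lemma primitive_applyLp (a : Icc t T) (M : C(Icc t T, V →L[ℝ] E)) (q : LpOn 1 t T V)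
    (s : Icc t T) : primitive a (applyLp 1 M q) s = ∫ r in a..s, extend M r (q r) :=
  intervalIntegral_congr_of_ae (coeFn_applyLp 1 M q) a s

lemma existsUnique_volterra [CompleteSpace E] (a : Icc t T) (b : C(Icc t T, E))
    (g : C(Icc t T, E) → C(Icc t T, V →L[ℝ] E)) {L : ℝ}
    (hg : ∀ X Y s, ‖g X s - g Y s‖ ≤ L * ‖X s - Y s‖) (q : LpOn 1 t T V) :
    ∃! X, X = b + primitive a (applyLp 1 (g X) q) := by
  have hq : Integrable (fun r => |L| * ‖q r‖) (volume.restrict (Icc t T)) :=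
    (L1.integrable_coeFn q).norm.const_mul |L|
  refine existsUnique_eq_of_norm_sub_le_integral a hq (fun r => by positivity) _ fun X Y s => ?_
  have hsub : uIoc (a : ℝ) s ⊆ Icc t T := uIoc_subset_uIcc.trans (uIcc_subset_Icc a.2 s.2)
  calc ‖(b + primitive a (applyLp 1 (g X) q)) s - (b + primitive a (applyLp 1 (g Y) q)) s‖
      = ‖∫ r in a..s, extend (g X - g Y) r (q r)‖ := by
        rw [← primitive_applyLp, map_sub, sub_apply, map_sub,
          ContinuousMap.add_apply, ContinuousMap.add_apply, add_sub_add_left_eq_sub]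
        rfl
    _ ≤ ∫ r in uIoc (a : ℝ) s, ‖extend (g X - g Y) r (q r)‖ :=
        intervalIntegral.norm_integral_le_integral_norm_uIoc
    _ ≤ ∫ r in uIoc (a : ℝ) s, |L| * ‖q r‖ * ‖extend (X - Y) r‖ := by
        refine integral_mono_of_nonneg (.of_forall fun r => norm_nonneg _)
          (IntegrableOn.mono_set (hq.mul_bdd (continuous_extend _).norm.aestronglyMeasurable
            (.of_forall fun r => (norm_norm _).trans_le (norm_extend_le (X - Y) r))) hsub) ?_
        filter_upwards [ae_restrict_mem measurableSet_uIoc] with r hr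
        rw [extend_of_mem _ (hsub hr), extend_of_mem _ (hsub hr), mul_right_comm]
        refine (ContinuousLinearMap.le_opNorm _ _).trans ?_
        gcongr
        exact (hg X Y _).trans (by gcongr; exacts [le_abs_self L, le_rfl])

lemma existsUnique_affine_volterra [CompleteSpace E] (a : Icc t T) (b : C(Icc t T, E))
    (M : C(Icc t T, E →L[ℝ] V →L[ℝ] E)) (d : C(Icc t T, V →L[ℝ] E)) (q : LpOn 1 t T V) :
    ∃! X, X = b + primitive a (applyLp 1 (d + pointwiseApply M X) q) := by
  refine existsUnique_volterra (L := ‖M‖) a b _ (fun X Y s => ?_) q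
  rw [ContinuousMap.add_apply, ContinuousMap.add_apply, add_sub_add_left_eq_sub,
    pointwiseApply_apply, pointwiseApply_apply, ← map_sub]
  exact (M s).le_of_opNorm_le (M.norm_coe_le_norm s) _

end Volterra

section FixedPoint

variable {P Z : Type*} [NormedAddCommGroup P] [NormedSpace ℝ P]
  [NormedAddCommGroup Z] [NormedSpace ℝ Z]

lemma isInvertible_id_sub [CompleteSpace Z] {L : Z →L[ℝ] Z} (hL : ∀ b, ∃! z, z = b + L z) :
    (ContinuousLinearMap.id ℝ Z - L).IsInvertible := by
  have hbij : Function.Bijective (ContinuousLinearMap.id ℝ Z - L) := by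
    refine (Function.bijective_iff_existsUnique _).2 fun b => ?_
    simpa only [sub_apply, ContinuousLinearMap.id_apply, sub_eq_iff_eq_add] using hL b
  exact ⟨.ofBijective _ (LinearMap.ker_eq_bot.2 hbij.1) (LinearMap.range_eq_top.2 hbij.2),
    ContinuousLinearEquiv.coe_ofBijective _ _ _⟩

lemma eq_linearization_iff {W' : P × Z →L[ℝ] Z} {z' : P →L[ℝ] Z}
    (hW' : ∀ b, ∃! z, z = b + W' (0, z)) (hz' : ∀ δ, z' δ = W' (δ, z' δ)) (δ : P) (z : Z) :
    z = W' (δ, z) ↔ z = z' δ := by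
  have hsplit : ∀ y, W' (δ, y) = W' (δ, 0) + W' (0, y) := fun y => by
    rw [← map_add, Prod.mk_add_mk, add_zero, zero_add]
  refine ⟨fun hz => (hW' (W' (δ, 0))).unique ?_ ?_, fun hz => hz ▸ hz' δ⟩
  · rwa [← hsplit]
  · rw [← hsplit]
    exact hz' δ

lemma exists_hasStrictFDerivAt_fixedPoint [CompleteSpace P] [CompleteSpace Z] {W : P × Z → Z}
    {W' : P × Z →L[ℝ] Z} {z : P → Z} {p : P} (hz : ∀ r y, y = W (r, y) ↔ y = z r)
    (hW : HasStrictFDerivAt W W' (p, z p)) (hW' : ∀ b, ∃! y, y = b + W' (0, y)) :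
    ∃ z' : P →L[ℝ] Z, HasStrictFDerivAt z z' p ∧ ∀ δ y, y = W' (δ, y) ↔ y = z' δ := by
  have hzW : ∀ r, z r = W (r, z r) := fun r => (hz r _).2 rfl
  have hres : HasStrictFDerivAt (fun r : P × Z => r.2 - W r)
      (ContinuousLinearMap.snd ℝ P Z - W') (p, z p) := hasStrictFDerivAt_snd.sub hW
  have hinv : ((ContinuousLinearMap.snd ℝ P Z - W') ∘L
      ContinuousLinearMap.inr ℝ P Z).IsInvertible :=
    isInvertible_id_sub (L := W' ∘L ContinuousLinearMap.inr ℝ P Z) hW'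
  have himplicit : hres.implicitFunctionOfProdDomain hinv =ᶠ[nhds p] z := by
    filter_upwards [hres.eventually_apply_implicitFunctionOfProdDomain hinv] with r hr
    rw [← hzW p, sub_self] at hr
    exact (hz r _).1 (sub_eq_zero.1 hr)
  obtain ⟨z', hz'⟩ : ∃ z', HasStrictFDerivAt z z' p :=
    ⟨_, (hres.hasStrictFDerivAt_implicitFunctionOfProdDomain hinv).congr_of_eventuallyEq himplicit⟩
  refine ⟨z', hz', eq_linearization_iff hW' fun δ => ?_⟩
  have hchain := (hW.comp p ((hasStrictFDerivAt_id p).prodMk hz')).hasFDerivAt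
  have hfix : (fun r => W (id r, z r)) = z := funext fun r => (hzW r).symm
  rw [hfix] at hchain
  exact DFunLike.congr_fun (hz'.hasFDerivAt.unique hchain) δ

end FixedPoint

section ParametricVolterra

variable {t T : ℝ} [hT : Fact (t ≤ T)] {P E V : Type*}
  [NormedAddCommGroup P] [NormedSpace ℝ P] [CompleteSpace P]
  [NormedAddCommGroup E] [NormedSpace ℝ E] [CompleteSpace E]
  [NormedAddCommGroup V] [NormedSpace ℝ V]

lemma exists_hasStrictFDerivAt_volterra (a : Icc t T) {b : P → C(Icc t T, E)}
    {g : P × C(Icc t T, E) → C(Icc t T, V →L[ℝ] E)} {q : P → LpOn 1 t T V} {z : P → C(Icc t T, E)}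
    (hz : ∀ r Z, Z = b r + primitive a (applyLp 1 (g (r, Z)) (q r)) ↔ Z = z r) {p : P}
    {b' : P →L[ℝ] C(Icc t T, E)} {g' : P × C(Icc t T, E) →L[ℝ] C(Icc t T, V →L[ℝ] E)}
    {q' : P →L[ℝ] LpOn 1 t T V} (hb : HasStrictFDerivAt b b' p)
    (hg : HasStrictFDerivAt g g' (p, z p)) (hq : HasStrictFDerivAt q q' p)
    {M : C(Icc t T, E →L[ℝ] V →L[ℝ] E)} (hM : ∀ Z, g' (0, Z) = pointwiseApply M Z) :
    ∃ z' : P →L[ℝ] C(Icc t T, E), HasStrictFDerivAt z z' p ∧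
      ∀ δ Z, Z = b' δ + primitive a (applyLp 1 (g (p, z p)) (q' δ) + applyLp 1 (g' (δ, Z)) (q p)) ↔
        Z = z' δ := by
  have hfst : HasStrictFDerivAt Prod.fst (ContinuousLinearMap.fst ℝ P C(Icc t T, E)) (p, z p) :=
    hasStrictFDerivAt_fst
  have hW := (hb.comp (p, z p) hfst).add ((primitive a).hasStrictFDerivAt.comp (p, z p)
    ((applyLp 1).hasStrictFDerivAt_of_bilinear hg (hq.comp (p, z p) hfst)))
  refine exists_hasStrictFDerivAt_fixedPoint hz hW fun d => ?_
  simpa [hM] using existsUnique_affine_volterra a d M 0 (q p)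

end ParametricVolterra

section Duality

variable {t T : ℝ} [hT : Fact (t ≤ T)] {E F : Type*} [NormedAddCommGroup E] [NormedSpace ℝ E]
  [NormedAddCommGroup F] [NormedSpace ℝ F]

/-- The left end point of `[t, T]`. -/
def left : Icc t T := ⟨t, left_mem_Icc.2 hT.out⟩

/-- The right end point of `[t, T]`. -/
def right : Icc t T := ⟨T, right_mem_Icc.2 hT.out⟩

lemma extend_primitive_left (φ : LpOn 1 t T E) {s : ℝ} (hs : s ∈ Icc t T) :
    extend (primitive left φ) s = ∫ r in Icc t T, (Iic s).indicator φ r := by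
  rw [extend_of_mem _ hs, primitive_apply, setIntegral_indicator measurableSet_Iic,
    show Icc t T ∩ Iic s = Icc t s by
      rw [← Ici_inter_Iic, inter_assoc, Iic_inter_Iic, min_eq_right hs.2, Ici_inter_Iic],
    integral_Icc_eq_integral_Ioc]
  exact intervalIntegral.integral_of_le hs.1

lemma extend_primitive_right (ψ : LpOn 1 t T F) {r : ℝ} (hr : r ∈ Icc t T) :
    extend (primitive right ψ) r = -∫ s in Icc t T, (Ici r).indicator ψ s := by
  rw [extend_of_mem _ hr, primitive_apply, setIntegral_indicator measurableSet_Ici,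
    show Icc t T ∩ Ici r = Icc r T by
      rw [inter_comm, ← Ici_inter_Iic, ← inter_assoc, Ici_inter_Ici, max_eq_left hr.1,
        Ici_inter_Iic],
    integral_Icc_eq_integral_Ioc, ← intervalIntegral.integral_of_le hr.2]
  exact intervalIntegral.integral_symm _ _

lemma integral_bilin_primitive [CompleteSpace E] [CompleteSpace F] (B : E →L[ℝ] F →L[ℝ] ℝ)
    (φ : LpOn 1 t T E) (ψ : LpOn 1 t T F) :
    ∫ s in Icc t T, B (extend (primitive left φ) s) (ψ s) =
      -∫ r in Icc t T, B (φ r) (extend (primitive right ψ) r) := by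
  have hφ := L1.integrable_coeFn φ
  have hψ := L1.integrable_coeFn ψ
  set triangle : Set (ℝ × ℝ) := {p | p.2 ≤ p.1}
  have hint : Integrable (triangle.indicator fun p => B (φ p.2) (ψ p.1))
      ((volume.restrict (Icc t T)).prod (volume.restrict (Icc t T))) := by
    refine Integrable.indicator ?_ (measurableSet_le measurable_snd measurable_fst)
    refine ((hψ.norm.mul_prod hφ.norm).const_mul ‖B‖).mono'
      (B.aestronglyMeasurable_comp₂ hφ.aestronglyMeasurable.comp_snd
        hψ.aestronglyMeasurable.comp_fst) (.of_forall fun p => ?_)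
    rw [mul_left_comm, ← mul_assoc, mul_comm ‖ψ p.1‖, mul_right_comm]
    exact (B.le_opNorm₂ _ _).trans (by linarith)
  have hrow : ∀ s r, triangle.indicator (fun p => B (φ p.2) (ψ p.1)) (s, r) =
      B ((Iic s).indicator φ r) (ψ s) := fun s r => by
    by_cases h : r ≤ s <;> simp [triangle, h]
  have hcol : ∀ s r, triangle.indicator (fun p => B (φ p.2) (ψ p.1)) (s, r) =
      B (φ r) ((Ici r).indicator ψ s) := fun s r => by
    by_cases h : r ≤ s <;> simp [triangle, h]
  calc ∫ s in Icc t T, B (extend (primitive left φ) s) (ψ s)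
      = ∫ s in Icc t T, ∫ r in Icc t T, triangle.indicator (fun p => B (φ p.2) (ψ p.1)) (s, r) := by
        refine setIntegral_congr_fun measurableSet_Icc fun s hs => ?_
        simp only [hrow, extend_primitive_left φ hs]
        exact ((B.flip (ψ s)).integral_comp_comm (hφ.indicator measurableSet_Iic)).symm
    _ = ∫ r in Icc t T, ∫ s in Icc t T, triangle.indicator (fun p => B (φ p.2) (ψ p.1)) (s, r) :=
        integral_integral_swap hint
    _ = ∫ r in Icc t T, -B (φ r) (extend (primitive right ψ) r) := by
        refine setIntegral_congr_fun measurableSet_Icc fun r hr => ?_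
        simp only [hcol, extend_primitive_right ψ hr, map_neg, neg_neg]
        exact (B (φ r)).integral_comp_comm (hψ.indicator measurableSet_Ici)
    _ = -∫ r in Icc t T, B (φ r) (extend (primitive right ψ) r) := integral_neg _

end Duality

/-! ### Control problems that are linear in an integrable control -/

section SecondDerivative

variable {E F G : Type*} [NormedAddCommGroup E] [NormedSpace ℝ E] [NormedAddCommGroup F]
  [NormedSpace ℝ F] [NormedAddCommGroup G] [NormedSpace ℝ G]

lemma fderiv_clm_comp_apply (M : F →L[ℝ] G) {g : E → F} {x : E} (hg : DifferentiableAt ℝ g x)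
    (a : E) : fderiv ℝ (fun y => M (g y)) x a = M (fderiv ℝ g x a) := by
  have h : HasFDerivAt (fun y => M (g y)) _ x := M.hasFDerivAt.comp x hg.hasFDerivAt
  rw [h.fderiv]
  rfl

lemma hasFDerivAt_fderiv_apply {g : E → F} (hg : ContDiff ℝ 2 g) (x z : E) :
    HasFDerivAt (fun y => fderiv ℝ g y z) ((fderiv ℝ (fderiv ℝ g) x).flip z) x :=
  (ContinuousLinearMap.apply ℝ F z).hasFDerivAt.comp x
    ((hg.fderiv_right one_add_one_eq_two.le).differentiable one_ne_zero x).hasFDerivAt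

lemma fderiv_fderiv_clm_comp_apply (M : F →L[ℝ] G) {g : E → F} (hg : ContDiff ℝ 2 g)
    (x a z : E) :
    fderiv ℝ (fderiv ℝ fun y => M (g y)) x a z = M (fderiv ℝ (fderiv ℝ g) x a z) := by
  have hM : ContDiff ℝ 2 (fun y => M (g y)) := M.contDiff.comp hg
  have h := hasFDerivAt_fderiv_apply hM x z
  simp_rw [fun y => fderiv_clm_comp_apply M (hg.differentiable two_ne_zero y) z] at h
  exact DFunLike.congr_fun
    (h.unique (M.hasFDerivAt.comp x (hasFDerivAt_fderiv_apply hg x z))) a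

lemma fderiv_fderiv_prodMk_apply {f : E → F} {g : E → G} (hf : ContDiff ℝ 2 f)
    (hg : ContDiff ℝ 2 g) (x a z : E) :
    fderiv ℝ (fderiv ℝ fun y => (f y, g y)) x a z =
      (fderiv ℝ (fderiv ℝ f) x a z, fderiv ℝ (fderiv ℝ g) x a z) :=
  Prod.ext (fderiv_fderiv_clm_comp_apply (.fst ℝ F G) (hf.prodMk hg) x a z).symm
    (fderiv_fderiv_clm_comp_apply (.snd ℝ F G) (hf.prodMk hg) x a z).symm

end SecondDerivative

section Coefficients

variable {t T : ℝ} {E F : Type*} [NormedAddCommGroup E] [NormedSpace ℝ E]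
  [NormedAddCommGroup F] [NormedSpace ℝ F]

/-- A time-dependent coefficient that is continuously differentiable in the state, jointly
continuously in time and state. -/
structure IsC1 (t T : ℝ) (g : ℝ → E → F) : Prop where
  continuous : Continuous fun p : Icc t T × E => g p.1 p.2
  differentiable : ∀ s ∈ Icc t T, Differentiable ℝ (g s)
  continuous_fderiv : Continuous fun p : Icc t T × E => fderiv ℝ (g p.1) p.2

namespace IsC1

variable {g : ℝ → E → F}

/-- The coefficient evaluated along a curve. -/
def along (hg : IsC1 t T g) (X : C(Icc t T, E)) : C(Icc t T, F) :=
  superposition ⟨_, hg.continuous⟩ X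

/-- The state derivative of the coefficient evaluated along a curve. -/
noncomputable def fderivAlong (hg : IsC1 t T g) (X : C(Icc t T, E)) : C(Icc t T, E →L[ℝ] F) :=
  superposition ⟨_, hg.continuous_fderiv⟩ X

@[simp] lemma along_apply (hg : IsC1 t T g) (X : C(Icc t T, E)) (s : Icc t T) :
    hg.along X s = g s (X s) := rfl

@[simp] lemma fderivAlong_apply (hg : IsC1 t T g) (X : C(Icc t T, E)) (s : Icc t T) :
    hg.fderivAlong X s = fderiv ℝ (g s) (X s) := rfl

lemma hasStrictFDerivAt_along (hg : IsC1 t T g) (X : C(Icc t T, E)) :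
    HasStrictFDerivAt hg.along (pointwiseApply (hg.fderivAlong X)) X :=
  hasStrictFDerivAt_superposition ⟨_, hg.continuous⟩ ⟨_, hg.continuous_fderiv⟩
    (fun s x => (hg.differentiable s s.2 x).hasFDerivAt) X

variable [Fact (t ≤ T)]

lemma extend_along (hg : IsC1 t T g) (X : C(Icc t T, E)) {s : ℝ} (hs : s ∈ Icc t T) :
    extend (hg.along X) s = g s (extend X s) := by
  simp only [extend_of_mem _ hs, along_apply]

variable {G : Type*} [NormedAddCommGroup G] [NormedSpace ℝ G] {N : ℝ → E → F →L[ℝ] G}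

lemma coeFn_applyLp_along (hN : IsC1 t T N) (p : ENNReal) [Fact (1 ≤ p)] (X : C(Icc t T, E))
    (φ : LpOn p t T F) :
    applyLp p (hN.along X) φ =ᵐ[volume.restrict (Icc t T)] fun s => N s (extend X s) (φ s) := by
  filter_upwards [coeFn_applyLp p (hN.along X) φ, ae_restrict_mem measurableSet_Icc] with s h hs
  rw [h, hN.extend_along X hs]

lemma coeFn_applyLp_fderivAlong (hN : IsC1 t T N) (p : ENNReal) [Fact (1 ≤ p)]
    (X X₁ : C(Icc t T, E)) (φ : LpOn p t T F) :
    applyLp p (pointwiseApply (hN.fderivAlong X) X₁) φ =ᵐ[volume.restrict (Icc t T)]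
      fun s => fderiv ℝ (N s) (extend X s) (extend X₁ s) (φ s) := by
  filter_upwards [coeFn_applyLp p (pointwiseApply (hN.fderivAlong X) X₁) φ,
    ae_restrict_mem measurableSet_Icc] with s h hs
  simp only [h, extend_of_mem _ hs, pointwiseApply_apply, fderivAlong_apply]

end IsC1

lemma contDiff_of_contDiffOn {K : Set ℝ} {g : ℝ → E → F} {k : WithTop ℕ∞}
    (hg : ContDiffOn ℝ k (fun p : ℝ × E => g p.1 p.2) (K ×ˢ univ)) {s : ℝ} (hs : s ∈ K) :
    ContDiff ℝ k (g s) :=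
  contDiffOn_univ.1 (hg.comp (contDiff_prodMk_right s).contDiffOn fun x _ => ⟨hs, mem_univ x⟩)

variable {K : Set ℝ} {g : ℝ → E → F}

lemma hasFDerivAt_of_contDiffOn (hg : ContDiffOn ℝ 1 (fun p : ℝ × E => g p.1 p.2) (K ×ˢ univ))
    {s : ℝ} (hs : s ∈ K) (x : E) :
    HasFDerivAt (g s) (fderivWithin ℝ (fun p : ℝ × E => g p.1 p.2) (K ×ˢ univ) (s, x) ∘L
      ContinuousLinearMap.inr ℝ ℝ E) x :=
  hasFDerivWithinAt_univ.1
    ((hg.differentiableOn one_ne_zero (s, x) ⟨hs, mem_univ x⟩).hasFDerivWithinAt.comp x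
      (hasFDerivAt_prodMk_right s x).hasFDerivWithinAt fun y _ => ⟨hs, mem_univ y⟩)

lemma contDiffOn_fderiv (hK : UniqueDiffOn ℝ K) {k l : WithTop ℕ∞} (hkl : k + 1 ≤ l)
    (hg : ContDiffOn ℝ l (fun p : ℝ × E => g p.1 p.2) (K ×ˢ univ)) :
    ContDiffOn ℝ k (fun p : ℝ × E => fderiv ℝ (g p.1) p.2) (K ×ˢ univ) := by
  have h := hg.fderivWithin (hK.prod uniqueDiffOn_univ) hkl
  exact (h.clm_comp contDiffOn_const).congr fun p hp =>
    (hasFDerivAt_of_contDiffOn (hg.of_le (le_add_self.trans hkl)) hp.1 p.2).fderiv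

lemma isC1_of_contDiffOn (hK : UniqueDiffOn ℝ K) (htK : Icc t T ⊆ K)
    (hg : ContDiffOn ℝ 1 (fun p : ℝ × E => g p.1 p.2) (K ×ˢ univ)) : IsC1 t T g := by
  have hmem : ∀ p : Icc t T × E, ((p.1 : ℝ), p.2) ∈ K ×ˢ (univ : Set E) := fun p =>
    ⟨htK p.1.2, mem_univ _⟩
  have hcoe : Continuous fun p : Icc t T × E => ((p.1 : ℝ), p.2) := by fun_prop
  exact ⟨hg.continuousOn.comp_continuous hcoe hmem,
    fun s hs x => (hasFDerivAt_of_contDiffOn hg (htK hs) x).differentiableAt,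
    (contDiffOn_fderiv hK (zero_add 1).le hg).continuousOn.comp_continuous hcoe hmem⟩

end Coefficients

/-- A control problem on `[t, T]` whose dynamics `X' = f(s, X) q(s)` and running cost `c(s, X) q(s)`
are linear in the control `q`, with terminal cost `G`. The coefficients are smooth on a set
`horizon` of times that may be larger than `[t, T]`, so that `t = T` is allowed. -/
structure ControlSystem (t T : ℝ) (E V : Type*) [NormedAddCommGroup E] [NormedSpace ℝ E]
    [NormedAddCommGroup V] [NormedSpace ℝ V] where
  f : ℝ → E → V →L[ℝ] E
  c : ℝ → E → V →L[ℝ] ℝ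
  G : E → ℝ
  horizon : Set ℝ
  uniqueDiffOn_horizon : UniqueDiffOn ℝ horizon
  Icc_subset_horizon : Icc t T ⊆ horizon
  contDiffOn_f : ContDiffOn ℝ 2 (fun p : ℝ × E => f p.1 p.2) (horizon ×ˢ univ)
  contDiffOn_c : ContDiffOn ℝ 2 (fun p : ℝ × E => c p.1 p.2) (horizon ×ˢ univ)
  contDiff_G : ContDiff ℝ 2 G
  L : NNReal
  lipschitz_f : ∀ s ∈ Icc t T, LipschitzWith L (f s)

namespace ControlSystem

section Forward

variable {t T : ℝ} {E V : Type*} [NormedAddCommGroup E] [NormedSpace ℝ E]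
  [NormedAddCommGroup V] [NormedSpace ℝ V] (S : ControlSystem t T E V)

lemma isC1_f : IsC1 t T S.f :=
  isC1_of_contDiffOn S.uniqueDiffOn_horizon S.Icc_subset_horizon (S.contDiffOn_f.of_le one_le_two)

lemma isC1_c : IsC1 t T S.c :=
  isC1_of_contDiffOn S.uniqueDiffOn_horizon S.Icc_subset_horizon (S.contDiffOn_c.of_le one_le_two)

variable [hT : Fact (t ≤ T)] [CompleteSpace E]

lemma existsUnique_trajectory (x : E) (q : LpOn 1 t T V) :
    ∃! X, X = constCurve x + primitive left (applyLp 1 (S.isC1_f.along X) q) :=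
  existsUnique_volterra left (constCurve x) S.isC1_f.along
    (fun X Y s => (S.lipschitz_f s s.2).norm_sub_le (X s) (Y s)) q

/-- The solution of `X' = f(s, X) q(s)`, `X(t) = x`. -/
noncomputable def trajectory (x : E) (q : LpOn 1 t T V) : C(Icc t T, E) :=
  (S.existsUnique_trajectory x q).choose

lemma eq_trajectory_iff (x : E) (q : LpOn 1 t T V) (X : C(Icc t T, E)) :
    X = constCurve x + primitive left (applyLp 1 (S.isC1_f.along X) q) ↔ X = S.trajectory x q :=
  (S.existsUnique_trajectory x q).choose_eq_iff.symm.trans eq_comm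

lemma exists_hasStrictFDerivAt_trajectory [CompleteSpace V] (x : E) (q : LpOn 1 t T V) :
    ∃ X' : LpOn 1 t T V →L[ℝ] C(Icc t T, E), HasStrictFDerivAt (S.trajectory x) X' q ∧
      ∀ δ X₁, X₁ = primitive left (applyLp 1 (S.isC1_f.along (S.trajectory x q)) δ +
        applyLp 1 (pointwiseApply (S.isC1_f.fderivAlong (S.trajectory x q)) X₁) q) ↔
          X₁ = X' δ := by
  obtain ⟨X', hX', hlin⟩ := exists_hasStrictFDerivAt_volterra left (b := fun _ => constCurve x)
    (g := fun r => S.isC1_f.along r.2) (q := id) (z := S.trajectory x)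
    (fun r X => S.eq_trajectory_iff x r X) (p := q) (hasStrictFDerivAt_const _ _)
    ((S.isC1_f.hasStrictFDerivAt_along (S.trajectory x q)).comp (q, S.trajectory x q)
      hasStrictFDerivAt_snd) (hasStrictFDerivAt_id _) fun _ => rfl
  exact ⟨X', hX', fun δ X₁ => by simpa using hlin δ X₁⟩

end Forward

end ControlSystem

section Gradient

variable {E : Type*} [NormedAddCommGroup E] [InnerProductSpace ℝ E] [CompleteSpace E]

/-- The Riesz isomorphism from linear forms to vectors, as an `ℝ`-linear operator: the inverse of
`InnerProductSpace.toDual` is only semilinear over the conjugation of `ℝ`. -/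
noncomputable def riesz : (E →L[ℝ] ℝ) →L[ℝ] E :=
  LinearMap.mkContinuous
    { toFun := (InnerProductSpace.toDual ℝ E).symm
      map_add' := map_add _
      map_smul' := map_smulₛₗ _ }
    1 fun φ => by simp

lemma inner_riesz (φ : E →L[ℝ] ℝ) (x : E) : ⟪riesz φ, x⟫_ℝ = φ x :=
  InnerProductSpace.toDual_symm_apply

lemma norm_riesz (φ : E →L[ℝ] ℝ) : ‖riesz φ‖ = ‖φ‖ :=
  (InnerProductSpace.toDual ℝ E).symm.norm_map φ

lemma gradient_eq_riesz (f : E → ℝ) (x : E) : ∇ f x = riesz (fderiv ℝ f x) := rfl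

lemma contDiff_gradient {f : E → ℝ} {k l : WithTop ℕ∞} (hf : ContDiff ℝ l f) (hkl : k + 1 ≤ l) :
    ContDiff ℝ k (∇ f) :=
  riesz.contDiff.comp (hf.fderiv_right hkl)

lemma inner_hess {k : ℕ} {f : Rn k → ℝ} (hf : ContDiff ℝ 2 f) (x a z : Rn k) :
    ⟪hess f x a, z⟫_ℝ = fderiv ℝ (fderiv ℝ f) x a z := by
  have h : HasFDerivAt (∇ f) _ x := riesz.hasFDerivAt.comp x
    ((hf.fderiv_right one_add_one_eq_two.le).differentiable one_ne_zero x).hasFDerivAt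
  rw [hess, h.fderiv]
  exact inner_riesz _ z

/-- The adjoint of operators, as an `ℝ`-linear operator: Mathlib's `ContinuousLinearMap.adjoint` is
only semilinear over the conjugation of `ℝ`. -/
noncomputable def adjointL {F : Type*} [NormedAddCommGroup F] [InnerProductSpace ℝ F]
    [CompleteSpace F] : (E →L[ℝ] F) →L[ℝ] F →L[ℝ] E :=
  LinearMap.mkContinuous
    { toFun := fun M => M†
      map_add' := map_add _
      map_smul' := map_smulₛₗ _ }
    1 fun M => by simp

lemma adjointL_apply {F : Type*} [NormedAddCommGroup F] [InnerProductSpace ℝ F]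
    [CompleteSpace F] (M : E →L[ℝ] F) : adjointL M = M† := rfl

end Gradient

namespace ControlSystem

section Hamiltonian

variable {t T : ℝ} {E V : Type*} [NormedAddCommGroup E] [InnerProductSpace ℝ E]
  [NormedAddCommGroup V] [NormedSpace ℝ V] (S : ControlSystem t T E V)

/-- The Hamiltonian `c(s, x) + ⟨y, f(s, x) ·⟩` at the state `x` and the costate `y`, a linear form
in the control value. -/
noncomputable def hamiltonian (s : ℝ) (y x : E) : V →L[ℝ] ℝ :=
  S.c s x + innerSL ℝ y ∘L S.f s x

lemma hamiltonian_apply (s : ℝ) (y x : E) (v : V) :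
    S.hamiltonian s y x v = S.c s x v + ⟪y, S.f s x v⟫_ℝ := rfl

variable [CompleteSpace E]

/-- The right-hand side `-H_x` of the adjoint equation at `p = (x, y)`, as an operator on the
control values. -/
noncomputable def costateField (s : ℝ) (p : E × E) : V →L[ℝ] E :=
  -(riesz ∘L (fderiv ℝ (S.c s) p.1 + (innerSL ℝ p.2).postcomp V ∘L fderiv ℝ (S.f s) p.1).flip)

lemma inner_costateField (s : ℝ) (p : E × E) (v : V) (z : E) :
    ⟪S.costateField s p v, z⟫_ℝ =
      -(fderiv ℝ (S.c s) p.1 z v + ⟪p.2, fderiv ℝ (S.f s) p.1 z v⟫_ℝ) := by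
  rw [costateField, neg_apply, inner_neg_left]
  exact congrArg Neg.neg (inner_riesz _ z)

lemma contDiffOn_costateField :
    ContDiffOn ℝ 1 (fun p : ℝ × E × E => S.costateField p.1 p.2) (S.horizon ×ˢ univ) := by
  have hproj : ContDiffOn ℝ 1 (fun p : ℝ × E × E => (p.1, p.2.1)) (S.horizon ×ˢ univ) := by
    fun_prop
  have hmaps : MapsTo (fun p : ℝ × E × E => (p.1, p.2.1)) (S.horizon ×ˢ univ)
      (S.horizon ×ˢ univ) := fun p hp => ⟨hp.1, mem_univ _⟩
  have hc := (contDiffOn_fderiv S.uniqueDiffOn_horizon one_add_one_eq_two.le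
    S.contDiffOn_c).comp hproj hmaps
  have hf := (contDiffOn_fderiv S.uniqueDiffOn_horizon one_add_one_eq_two.le
    S.contDiffOn_f).comp hproj hmaps
  have hy : ContDiff ℝ 1 fun p : ℝ × E × E => (innerSL ℝ p.2.2).postcomp V :=
    ((ContinuousLinearMap.compL ℝ V E ℝ).contDiff.comp (innerSL ℝ).contDiff).comp
      contDiff_snd.snd
  have hflip := (ContinuousLinearMap.flipₗᵢ ℝ E V ℝ).contDiff.comp_contDiffOn
    (hc.add (hy.contDiffOn.clm_comp hf))
  exact (contDiffOn_const.clm_comp hflip).neg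

lemma isC1_costateField : IsC1 t T S.costateField :=
  isC1_of_contDiffOn S.uniqueDiffOn_horizon S.Icc_subset_horizon S.contDiffOn_costateField

lemma norm_costateField_sub_le {s : ℝ} (hs : s ∈ Icc t T) (x y y' : E) :
    ‖S.costateField s (x, y) - S.costateField s (x, y')‖ ≤ S.L * ‖y - y'‖ := by
  have hderiv : ‖fderiv ℝ (S.f s) x‖ ≤ S.L := norm_fderiv_le_of_lipschitz ℝ (S.lipschitz_f s hs)
  have hsub : S.costateField s (x, y) - S.costateField s (x, y') =
      -(riesz ∘L ((innerSL ℝ (y - y')).postcomp V ∘L fderiv ℝ (S.f s) x).flip) := by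
    ext v
    refine ext_inner_right ℝ fun z => ?_
    rw [sub_apply, inner_sub_left, inner_costateField, inner_costateField, neg_apply,
      inner_neg_left]
    erw [inner_riesz]
    simp
    ring
  rw [hsub, norm_neg]
  refine ContinuousLinearMap.opNorm_le_bound _ (by positivity) fun v => ?_
  rw [ContinuousLinearMap.comp_apply, norm_riesz]
  refine ContinuousLinearMap.opNorm_le_bound _ (by positivity) fun z => ?_
  calc ‖⟪y - y', fderiv ℝ (S.f s) x z v⟫_ℝ‖
      ≤ ‖y - y'‖ * ‖fderiv ℝ (S.f s) x z v‖ := norm_inner_le_norm _ _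
    _ ≤ ‖y - y'‖ * (S.L * ‖z‖ * ‖v‖) := by
        gcongr
        exact (fderiv ℝ (S.f s) x z).le_of_opNorm_le
          ((fderiv ℝ (S.f s) x).le_of_opNorm_le hderiv z) v
    _ = S.L * ‖y - y'‖ * ‖v‖ * ‖z‖ := by ring

lemma inner_fderiv_costateField {s : ℝ} (hs : s ∈ Icc t T) (p δ : E × E) (v : V) (z : E) :
    ⟪fderiv ℝ (S.costateField s) p δ v, z⟫_ℝ =
      -(fderiv ℝ (fderiv ℝ (S.c s)) p.1 δ.1 z v +
        (⟪p.2, fderiv ℝ (fderiv ℝ (S.f s)) p.1 δ.1 z v⟫_ℝ +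
          ⟪δ.2, fderiv ℝ (S.f s) p.1 z v⟫_ℝ)) := by
  have hf := hasFDerivAt_fderiv_apply
    (contDiff_of_contDiffOn S.contDiffOn_f (S.Icc_subset_horizon hs)) p.1 z
  have hc := hasFDerivAt_fderiv_apply
    (contDiff_of_contDiffOn S.contDiffOn_c (S.Icc_subset_horizon hs)) p.1 z
  have hleft : HasFDerivAt (fun p => ⟪S.costateField s p v, z⟫_ℝ) _ p :=
    ((S.isC1_costateField.differentiable s hs p).hasFDerivAt.clm_apply
      (hasFDerivAt_const v p)).inner ℝ (hasFDerivAt_const z p)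
  have hright : HasFDerivAt (fun p : E × E =>
      -(fderiv ℝ (S.c s) p.1 z v + ⟪p.2, fderiv ℝ (S.f s) p.1 z v⟫_ℝ)) _ p :=
    (((hc.comp p hasFDerivAt_fst).clm_apply (hasFDerivAt_const v p)).add
      (HasFDerivAt.inner ℝ hasFDerivAt_snd
        ((hf.comp p hasFDerivAt_fst).clm_apply (hasFDerivAt_const v p)))).neg
  simp_rw [S.inner_costateField s _ v z] at hleft
  simpa using DFunLike.congr_fun (hleft.unique hright) δ

end Hamiltonian

section Costate

variable {t T : ℝ} {E V : Type*} [NormedAddCommGroup E] [InnerProductSpace ℝ E]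
  [NormedAddCommGroup V] [NormedSpace ℝ V] (S : ControlSystem t T E V)
  [hT : Fact (t ≤ T)] [CompleteSpace E]

lemma existsUnique_costate (X : C(Icc t T, E)) (q : LpOn 1 t T V) :
    ∃! Y, Y = constCurve (∇ S.G (X right)) +
      primitive right (applyLp 1 (S.isC1_costateField.along (curvePair (X, Y))) q) :=
  existsUnique_volterra right (constCurve (∇ S.G (X right)))
    (fun Y => S.isC1_costateField.along (curvePair (X, Y)))
    (fun Y Z s => by simpa using S.norm_costateField_sub_le s.2 (X s) (Y s) (Z s)) q

/-- The solution of the adjoint equation `Y' = -H_x(s, X, Y) q(s)`, `Y(T) = ∇G(X(T))`, along the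
trajectory `X` from `x`. -/
noncomputable def costate (x : E) (q : LpOn 1 t T V) : C(Icc t T, E) :=
  (S.existsUnique_costate (S.trajectory x q) q).choose

lemma eq_costate_iff (x : E) (q : LpOn 1 t T V) (Y : C(Icc t T, E)) :
    Y = constCurve (∇ S.G (S.trajectory x q right)) + primitive right
        (applyLp 1 (S.isC1_costateField.along (curvePair (S.trajectory x q, Y))) q) ↔
      Y = S.costate x q :=
  (S.existsUnique_costate (S.trajectory x q) q).choose_eq_iff.symm.trans eq_comm

lemma exists_hasStrictFDerivAt_costate [CompleteSpace V] (x : E) (q : LpOn 1 t T V)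
    {X' : LpOn 1 t T V →L[ℝ] C(Icc t T, E)} (hX' : HasStrictFDerivAt (S.trajectory x) X' q) :
    ∃ Y' : LpOn 1 t T V →L[ℝ] C(Icc t T, E), HasStrictFDerivAt (S.costate x) Y' q ∧
      ∀ δ Y₁, Y₁ = constCurve (fderiv ℝ (∇ S.G) (S.trajectory x q right) (X' δ right)) +
          primitive right
            (applyLp 1 (S.isC1_costateField.along
                (curvePair (S.trajectory x q, S.costate x q))) δ +
              applyLp 1 (pointwiseApply (S.isC1_costateField.fderivAlong
                (curvePair (S.trajectory x q, S.costate x q))) (curvePair (X' δ, Y₁))) q) ↔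
        Y₁ = Y' δ := by
  have hG : HasStrictFDerivAt (∇ S.G) (fderiv ℝ (∇ S.G) (S.trajectory x q right))
      (S.trajectory x q right) :=
    (contDiff_gradient S.contDiff_G one_add_one_eq_two.le).contDiffAt.hasStrictFDerivAt one_ne_zero
  have hterminal : HasStrictFDerivAt (fun r => constCurve (∇ S.G (S.trajectory x r right)))
      (constCurve ∘L fderiv ℝ (∇ S.G) (S.trajectory x q right) ∘L
        ContinuousMap.evalCLM ℝ right ∘L X') q :=
    (constCurve (K := Icc t T)).hasStrictFDerivAt.comp q
      (hG.comp q ((ContinuousMap.evalCLM ℝ right).hasStrictFDerivAt.comp q hX'))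
  have hpair : HasStrictFDerivAt (fun p : LpOn 1 t T V × C(Icc t T, E) =>
      curvePair (S.trajectory x p.1, p.2)) _ (q, S.costate x q) :=
    (curvePair (K := Icc t T) (E := E) (F := E)).hasStrictFDerivAt.comp (q, S.costate x q)
      ((hX'.comp (q, S.costate x q) hasStrictFDerivAt_fst).prodMk hasStrictFDerivAt_snd)
  obtain ⟨Y', hY', hlin⟩ := exists_hasStrictFDerivAt_volterra right
    (b := fun r => constCurve (∇ S.G (S.trajectory x r right)))
    (g := fun p => S.isC1_costateField.along (curvePair (S.trajectory x p.1, p.2)))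
    (q := id) (z := S.costate x) (fun r Y => S.eq_costate_iff x r Y) (p := q) hterminal
    ((S.isC1_costateField.hasStrictFDerivAt_along _).comp (q, S.costate x q) hpair)
    (hasStrictFDerivAt_id _)
    (M := ⟨fun s => S.isC1_costateField.fderivAlong
      (curvePair (S.trajectory x q, S.costate x q)) s ∘L ContinuousLinearMap.inr ℝ E E,
        by fun_prop⟩) fun Z => by ext; simp
  exact ⟨Y', hY', fun δ Y₁ => by simpa using hlin δ Y₁⟩

end Costate
end ControlSystem

section InnerDuality

variable {t T : ℝ} [hT : Fact (t ≤ T)] {E : Type*} [NormedAddCommGroup E]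

lemma primitive_left_right [NormedSpace ℝ E] (φ : LpOn 1 t T E) :
    primitive left φ right = ∫ s in Icc t T, φ s := by
  rw [integral_Icc_eq_integral_Ioc]
  exact intervalIntegral.integral_of_le hT.out

variable [InnerProductSpace ℝ E]

/-- The linear forms `⟨Y(s), ·⟩` along a curve `Y`. -/
noncomputable def innerCurve (Y : C(Icc t T, E)) : C(Icc t T, E →L[ℝ] ℝ) :=
  ⟨fun s => innerSL ℝ (Y s), by fun_prop⟩

lemma coeFn_applyLp_innerCurve (Y : C(Icc t T, E)) (φ : LpOn 1 t T E) :
    applyLp 1 (innerCurve Y) φ =ᵐ[volume.restrict (Icc t T)] fun s => ⟪extend Y s, φ s⟫_ℝ :=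
  coeFn_applyLp 1 (innerCurve Y) φ

lemma inner_primitive_left_right [CompleteSpace E] (y : E) (φ ψ : LpOn 1 t T E) :
    ⟪y, primitive left φ right⟫_ℝ =
      primitive left (applyLp 1 (innerCurve (constCurve y + primitive right ψ)) φ +
        applyLp 1 (innerCurve (primitive left φ)) ψ) right := by
  have hsplit : innerCurve (constCurve y + primitive right ψ) =
      innerCurve (constCurve y) + innerCurve (primitive right ψ) := by
    ext s z; simp [innerCurve]
  have hconst : primitive left (applyLp 1 (innerCurve (constCurve y)) φ) right =
      ⟪y, primitive left φ right⟫_ℝ := by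
    rw [primitive_left_right, primitive_left_right, ← integral_inner (L1.integrable_coeFn φ)]
    exact integral_congr_ae (coeFn_applyLp_innerCurve _ φ)
  have hparts : primitive left (applyLp 1 (innerCurve (primitive left φ)) ψ) right =
      -primitive left (applyLp 1 (innerCurve (primitive right ψ)) φ) right := by
    rw [primitive_left_right, primitive_left_right,
      integral_congr_ae (coeFn_applyLp_innerCurve _ ψ),
      integral_congr_ae (coeFn_applyLp_innerCurve _ φ)]
    simp only [fun s => real_inner_comm (φ s)]
    exact integral_bilin_primitive (innerSL ℝ) φ ψ
  simp only [hsplit, map_add, add_apply, ContinuousMap.add_apply, hconst, hparts]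
  ring

end InnerDuality

namespace ControlSystem

section Cost

variable {t T : ℝ} {E V : Type*} [NormedAddCommGroup E] [InnerProductSpace ℝ E]
  [NormedAddCommGroup V] [NormedSpace ℝ V] (S : ControlSystem t T E V)
  [hT : Fact (t ≤ T)] [CompleteSpace E]

/-- The cost `∫ c(s, X) q(s) ds + G(X(T))` of the control `q` at the initial state `x`. -/
noncomputable def cost (x : E) (q : LpOn 1 t T V) : ℝ :=
  primitive left (applyLp 1 (S.isC1_c.along (S.trajectory x q)) q) right +
    S.G (S.trajectory x q right)

/-- The Hamiltonian along the trajectory and the costate of the control `q`. -/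
noncomputable def hamiltonianAlong (x : E) (q : LpOn 1 t T V) : C(Icc t T, V →L[ℝ] ℝ) :=
  S.isC1_c.along (S.trajectory x q) +
    compCurve (innerCurve (S.costate x q)) (S.isC1_f.along (S.trajectory x q))

lemma hamiltonianAlong_apply (x : E) (q : LpOn 1 t T V) (s : Icc t T) :
    S.hamiltonianAlong x q s = S.hamiltonian s (S.costate x q s) (S.trajectory x q s) := rfl

lemma linearizedCost_eq_hamiltonianAlong (x : E) (q δ : LpOn 1 t T V) {X₁ : C(Icc t T, E)}
    (hX₁ : X₁ = primitive left (applyLp 1 (S.isC1_f.along (S.trajectory x q)) δ +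
      applyLp 1 (pointwiseApply (S.isC1_f.fderivAlong (S.trajectory x q)) X₁) q)) :
    primitive left (applyLp 1 (S.isC1_c.along (S.trajectory x q)) δ +
        applyLp 1 (pointwiseApply (S.isC1_c.fderivAlong (S.trajectory x q)) X₁) q) right +
      ⟪∇ S.G (S.trajectory x q right), X₁ right⟫_ℝ =
        primitive left (applyLp 1 (S.hamiltonianAlong x q) δ) right := by
  set X := S.trajectory x q
  set Y := S.costate x q
  have hcancel : pointwiseApply (S.isC1_c.fderivAlong X) X₁ +
      compCurve (innerCurve Y) (pointwiseApply (S.isC1_f.fderivAlong X) X₁) +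
      compCurve (innerCurve X₁) (S.isC1_costateField.along (curvePair (X, Y))) = 0 := by
    ext s v
    have h := S.inner_costateField s (X s, Y s) v (X₁ s)
    rw [real_inner_comm] at h
    simp [innerCurve, h]
  have hduality := inner_primitive_left_right (∇ S.G (X right))
    (applyLp 1 (S.isC1_f.along X) δ +
      applyLp 1 (pointwiseApply (S.isC1_f.fderivAlong X) X₁) q)
    (applyLp 1 (S.isC1_costateField.along (curvePair (X, Y))) q)
  rw [← hX₁, ← (S.eq_costate_iff x q Y).2 rfl, map_add (applyLp 1 (innerCurve Y)),
    applyLp_applyLp, applyLp_applyLp, applyLp_applyLp] at hduality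
  rw [hduality, ← ContinuousMap.add_apply, ← map_add]
  refine congrArg (fun φ => primitive left φ right) ?_
  have hzero := congrArg (fun M => applyLp 1 M q) hcancel
  simp only [map_add, add_apply, map_zero, zero_apply] at hzero
  refine Eq.trans ?_ (add_zero _)
  rw [hamiltonianAlong, map_add, add_apply, ← hzero]
  abel

lemma hasStrictFDerivAt_cost [CompleteSpace V] (x : E) (q : LpOn 1 t T V) :
    HasStrictFDerivAt (S.cost x)
      (ContinuousMap.evalCLM ℝ right ∘L primitive left ∘L applyLp 1 (S.hamiltonianAlong x q))
      q := by
  obtain ⟨X', hX', hlin⟩ := S.exists_hasStrictFDerivAt_trajectory x q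
  have hG : HasStrictFDerivAt S.G (fderiv ℝ S.G (S.trajectory x q right))
      (S.trajectory x q right) :=
    S.contDiff_G.contDiffAt.hasStrictFDerivAt two_ne_zero
  have hrunning := (applyLp 1).hasStrictFDerivAt_of_bilinear
    ((S.isC1_c.hasStrictFDerivAt_along (S.trajectory x q)).comp q hX') (hasStrictFDerivAt_id q)
  have h := ((ContinuousMap.evalCLM ℝ right ∘L primitive left).hasStrictFDerivAt.comp q
    hrunning).add (hG.comp q ((ContinuousMap.evalCLM ℝ right).hasStrictFDerivAt.comp q hX'))
  refine h.congr_fderiv (ContinuousLinearMap.ext fun δ => ?_)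
  refine Eq.trans ?_ (S.linearizedCost_eq_hamiltonianAlong x q δ ((hlin δ _).2 rfl))
  rw [gradient_eq_riesz, inner_riesz]
  simp

end Cost
end ControlSystem

/-! ### Carathéodory solutions -/

section Caratheodory

variable {t T : ℝ} [hT : Fact (t ≤ T)]

lemma primitive_eq_constCurve_add {E : Type*} [NormedAddCommGroup E] [NormedSpace ℝ E]
    (a b : Icc t T) (φ : LpOn 1 t T E) :
    primitive a φ = constCurve (primitive a φ b) + primitive b φ :=
  ContinuousMap.ext fun s => (intervalIntegral.integral_add_adjacent_intervals
    (intervalIntegrable_of_integrable (L1.integrable_coeFn φ) a b)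
    (intervalIntegrable_of_integrable (L1.integrable_coeFn φ) b s)).symm

variable {k : ℕ} {X : ℝ → Rn k}

lemma solvesODE_iff_eqOn_extend {F : ℝ → Rn k} {φ : LpOn 1 t T (Rn k)}
    (hφ : φ =ᵐ[volume.restrict (Icc t T)] F) :
    SolvesODE t T X F ↔ EqOn X (extend (constCurve (X t) + primitive left φ)) (Icc t T) := by
  have hint : IntervalIntegrable F volume t T :=
    intervalIntegrable_of_integrable ((L1.integrable_coeFn φ).congr hφ) left right
  refine (and_iff_right hint).trans (forall₂_congr fun s hs => ?_)
  rw [extend_of_mem _ hs]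
  exact Eq.congr_right (congrArg _ (intervalIntegral_congr_of_ae hφ left ⟨s, hs⟩).symm)

lemma solvesODE_iff_of_volterra {F : ℝ → Rn k → Rn k} {a : Icc t T} {e : Rn k}
    {Φ : C(Icc t T, Rn k) → LpOn 1 t T (Rn k)} {Z₀ : C(Icc t T, Rn k)}
    (hΦ : ∀ Z, Φ Z =ᵐ[volume.restrict (Icc t T)] fun s => F s (extend Z s))
    (hZ₀ : ∀ Z, Z = constCurve e + primitive a (Φ Z) ↔ Z = Z₀) :
    SolvesODE t T X (fun s => F s (X s)) ∧ X a = e ↔ EqOn X (extend Z₀) (Icc t T) := by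
  have hcongr : ∀ Z, EqOn X (extend Z) (Icc t T) →
      Φ Z =ᵐ[volume.restrict (Icc t T)] fun s => F s (X s) := fun Z hXZ => by
    filter_upwards [hΦ Z, ae_restrict_mem measurableSet_Icc] with s hs hmem
    rw [hs, hXZ hmem]
  constructor
  · rintro ⟨hX, ha⟩
    have hF : Integrable (fun s => F s (X s)) (volume.restrict (Icc t T)) :=
      (integrableOn_Icc_iff_integrableOn_Ioc).2
        ((intervalIntegrable_iff_integrableOn_Ioc_of_le hT.out).1 hX.1)
    set Z := constCurve (X t) + primitive left (hF.toL1 _)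
    have hXZ : EqOn X (extend Z) (Icc t T) := (solvesODE_iff_eqOn_extend hF.coeFn_toL1).1 hX
    have hΦZ : Φ Z = hF.toL1 _ := Lp.ext ((hcongr Z hXZ).trans hF.coeFn_toL1.symm)
    have he : X t + primitive left (hF.toL1 _) a = e := by
      rw [← ha, hXZ a.2, extend_coe]; rfl
    rwa [← (hZ₀ Z).1]
    rw [hΦZ, ← he, map_add, add_assoc, ← primitive_eq_constCurve_add]
  · intro hX
    have hfix := (hZ₀ Z₀).2 rfl
    have hXt : X t = e + primitive a (Φ Z₀) left :=
      (hX left.2).trans ((extend_coe Z₀ left).trans (DFunLike.congr_fun hfix left))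
    refine ⟨(solvesODE_iff_eqOn_extend (hcongr Z₀ hX)).2 ?_, ?_⟩
    · rwa [hXt, map_add, add_assoc, ← primitive_eq_constCurve_add, ← hfix]
    · rw [hX a.2, extend_coe, hfix]
      simp [primitive_apply]

end Caratheodory

/-! ### Quadratic dependence on a square-integrable control -/

section QuadraticMaps

variable {t T : ℝ} [hT : Fact (t ≤ T)] {U V : Type*} [NormedAddCommGroup U] [NormedSpace ℝ U]
  [NormedAddCommGroup V] [NormedSpace ℝ V]

/-- The control `u` augmented by the constant component `1`. -/
noncomputable def augment (u : LpOn 2 t T U) : LpOn 2 t T (ℝ × U) :=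
  curveToLp 2 (constCurve (1, 0)) + (ContinuousLinearMap.inr ℝ ℝ U).compLpL 2 _ u

lemma coeFn_augment (u : LpOn 2 t T U) :
    augment u =ᵐ[volume.restrict (Icc t T)] fun s => (1, u s) := by
  filter_upwards [Lp.coeFn_add (curveToLp 2 (constCurve ((1 : ℝ), (0 : U))))
      ((ContinuousLinearMap.inr ℝ ℝ U).compLpL 2 _ u),
    coeFn_curveToLp 2 (constCurve ((1 : ℝ), (0 : U))), ae_restrict_mem measurableSet_Icc,
    (ContinuousLinearMap.inr ℝ ℝ U).coeFn_compLpL u] with s hadd hconst hs hinr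
  rw [augment, hadd, Pi.add_apply, hconst, hinr, extend_of_mem _ hs]
  simp

/-- The values `β ((1, u), (1, u))` of the quadratic map with polar form `β` on a control of finite
energy, as an integrable function. -/
noncomputable def quadraticLp (β : (ℝ × U) →L[ℝ] (ℝ × U) →L[ℝ] V) (u : LpOn 2 t T U) :
    LpOn 1 t T V :=
  β.holder 1 (augment u) (augment u)

lemma coeFn_quadraticLp (β : (ℝ × U) →L[ℝ] (ℝ × U) →L[ℝ] V) (u : LpOn 2 t T U) :
    quadraticLp β u =ᵐ[volume.restrict (Icc t T)] fun s => β (1, u s) (1, u s) := by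
  filter_upwards [β.coeFn_holder (r := 1) (augment u) (augment u), coeFn_augment u] with s hs hu
  rw [quadraticLp, hs, hu]

lemma exists_hasStrictFDerivAt_quadraticLp (β : (ℝ × U) →L[ℝ] (ℝ × U) →L[ℝ] V)
    (u : LpOn 2 t T U) :
    ∃ q' : LpOn 2 t T U →L[ℝ] LpOn 1 t T V, HasStrictFDerivAt (quadraticLp β) q' u ∧
      ∀ v, q' v =ᵐ[volume.restrict (Icc t T)]
        fun s => β (1, u s) (0, v s) + β (0, v s) (1, u s) := by
  have haug : HasStrictFDerivAt augment
      ((ContinuousLinearMap.inr ℝ ℝ U).compLpL 2 (volume.restrict (Icc t T))) u :=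
    (ContinuousLinearMap.hasStrictFDerivAt _).const_add _
  refine ⟨_, (β.holderL (volume.restrict (Icc t T)) 2 2 1).hasStrictFDerivAt_of_bilinear haug haug,
    fun v => ?_⟩
  set v₀ := (ContinuousLinearMap.inr ℝ ℝ U).compLpL 2 (volume.restrict (Icc t T)) v
  filter_upwards [Lp.coeFn_add (β.holder 1 (augment u) v₀) (β.holder 1 v₀ (augment u)),
    β.coeFn_holder (r := 1) (augment u) v₀, β.coeFn_holder (r := 1) v₀ (augment u),
    coeFn_augment u, (ContinuousLinearMap.inr ℝ ℝ U).coeFn_compLpL v] with s hadd huv hvu hu hv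
  refine hadd.trans ?_
  rw [Pi.add_apply, huv, hvu, hu, hv]
  rfl

end QuadraticMaps

section Monomials

variable {U : Type*} [NormedAddCommGroup U] [InnerProductSpace ℝ U]

/-- The space of the monomials `(1, w, w ⊗ w)` of a control value `w`. The tensor `w ⊗ z` is encoded
as the linear form `N ↦ ⟨N w, z⟩` on operators. -/
abbrev Monomials (U : Type*) [NormedAddCommGroup U] [InnerProductSpace ℝ U] : Type _ :=
  ℝ × U × ((U →L[ℝ] U) →L[ℝ] ℝ)

/-- The tensor `w ⊗ z` as a linear form on operators. -/
noncomputable def tensorForm (w z : U) : (U →L[ℝ] U) →L[ℝ] ℝ :=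
  innerSL ℝ z ∘L ContinuousLinearMap.apply ℝ U w

@[simp] lemma tensorForm_apply (w z : U) (N : U →L[ℝ] U) : tensorForm w z N = ⟪N w, z⟫_ℝ :=
  real_inner_comm _ _

/-- The bilinear map `(α, w), (β, z) ↦ (α β, α z, w ⊗ z)`, whose values on the diagonal at `(1, w)`
are the monomials of `w`. -/
noncomputable def polarMonomials : (ℝ × U) →L[ℝ] (ℝ × U) →L[ℝ] Monomials U :=
  LinearMap.mkContinuous₂
    (LinearMap.mk₂ ℝ (fun a b => (a.1 * b.1, a.1 • b.2, tensorForm a.2 b.2))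
      (fun a a' b => by ext <;> simp [add_mul, add_smul, inner_add_left])
      (fun r a b => by ext <;> simp [mul_assoc, mul_smul, inner_smul_left])
      (fun a b b' => by ext <;> simp [mul_add, inner_add_right])
      (fun r a b => by
        ext <;> simp [mul_left_comm, smul_comm a.1 r, inner_smul_right]))
    1 fun a b => by
      have hα := norm_fst_le a
      have hw := norm_snd_le a
      have hβ := norm_fst_le b
      have hz := norm_snd_le b
      rw [one_mul]
      refine norm_prod_le_iff.2 ⟨?_, norm_prod_le_iff.2 ⟨?_, ?_⟩⟩
      · exact (norm_mul_le _ _).trans (by gcongr)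
      · exact (norm_smul_le _ _).trans (by gcongr)
      · refine ContinuousLinearMap.opNorm_le_bound _ (by positivity) fun N => ?_
        calc ‖tensorForm a.2 b.2 N‖ ≤ ‖N‖ * ‖a.2‖ * ‖b.2‖ := by
              rw [tensorForm_apply]
              exact (norm_inner_le_norm _ _).trans (by gcongr; exact N.le_opNorm _)
          _ ≤ ‖N‖ * ‖a‖ * ‖b‖ := by gcongr
          _ = ‖a‖ * ‖b‖ * ‖N‖ := by ring

@[simp] lemma polarMonomials_apply (a b : ℝ × U) :
    polarMonomials a b = (a.1 * b.1, a.1 • b.2, tensorForm a.2 b.2) := rfl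

/-- The monomials `(1, w, w ⊗ w)` of `w`. -/
noncomputable def monomials (w : U) : Monomials U := (1, w, tensorForm w w)

/-- The derivative of the monomials at `w` in the direction `v`. -/
noncomputable def monomialsDeriv (w v : U) : Monomials U := (0, v, tensorForm w v + tensorForm v w)

variable {t T : ℝ} [hT : Fact (t ≤ T)]

/-- The monomials of a control of finite energy, as an integrable function. -/
noncomputable def monomialsLp : LpOn 2 t T U → LpOn 1 t T (Monomials U) :=
  quadraticLp polarMonomials

lemma coeFn_monomialsLp (u : LpOn 2 t T U) :
    monomialsLp u =ᵐ[volume.restrict (Icc t T)] fun s => monomials (u s) := by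
  filter_upwards [coeFn_quadraticLp polarMonomials u] with s hs
  exact hs.trans (by simp [monomials])

lemma exists_hasStrictFDerivAt_monomialsLp (u : LpOn 2 t T U) :
    ∃ q' : LpOn 2 t T U →L[ℝ] LpOn 1 t T (Monomials U), HasStrictFDerivAt monomialsLp q' u ∧
      ∀ v, q' v =ᵐ[volume.restrict (Icc t T)] fun s => monomialsDeriv (u s) (v s) := by
  obtain ⟨q', hq', hcoe⟩ := exists_hasStrictFDerivAt_quadraticLp polarMonomials u
  refine ⟨q', hq', fun v => ?_⟩
  filter_upwards [hcoe v] with s hs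
  exact hs.trans (by simp [monomialsDeriv])

end Monomials

section AffineQuadratic

variable {E U : Type*} [NormedAddCommGroup E] [NormedSpace ℝ E] [NormedAddCommGroup U]
  [InnerProductSpace ℝ U]

/-- The operator on monomials with value `A + B w` at the monomials of `w`. -/
noncomputable def affineDrift : E × (U →L[ℝ] E) →L[ℝ] Monomials U →L[ℝ] E :=
  (ContinuousLinearMap.smulRightL ℝ (Monomials U) E (.fst ℝ _ _)).coprod
    ((ContinuousLinearMap.compL ℝ (Monomials U) U E).flip (.fst ℝ _ _ ∘L .snd ℝ _ _))

@[simp] lemma affineDrift_apply (p : E × (U →L[ℝ] E)) (v : Monomials U) :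
    affineDrift p v = v.1 • p.1 + p.2 v.2.1 := rfl

/-- The form on monomials with value `Q + ⟨S, w⟩ + ⟨R w, w⟩ / 2` at the monomials of `w`. -/
noncomputable def quadraticCost : ℝ × U × (U →L[ℝ] U) →L[ℝ] Monomials U →L[ℝ] ℝ :=
  (ContinuousLinearMap.smulRightL ℝ (Monomials U) ℝ (.fst ℝ _ _)).coprod
    (((ContinuousLinearMap.compL ℝ (Monomials U) U ℝ).flip (.fst ℝ _ _ ∘L .snd ℝ _ _) ∘L
      innerSL ℝ).coprod
    ((1 / 2 : ℝ) • ((ContinuousLinearMap.compL ℝ (Monomials U) _ ℝ).flip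
      (.snd ℝ _ _ ∘L .snd ℝ _ _) ∘L (ContinuousLinearMap.id ℝ ((U →L[ℝ] U) →L[ℝ] ℝ)).flip)))

@[simp] lemma quadraticCost_apply (p : ℝ × U × (U →L[ℝ] U)) (v : Monomials U) :
    quadraticCost p v = v.1 * p.1 + (⟪p.2.1, v.2.1⟫_ℝ + 1 / 2 * v.2.2 p.2.2) := rfl

lemma contDiffOn_affineDrift {W : Type*} [NormedAddCommGroup W] [NormedSpace ℝ W] {K : Set W}
    {k : WithTop ℕ∞} {A : W → E} {B : W → U →L[ℝ] E} (hA : ContDiffOn ℝ k A K)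
    (hB : ContDiffOn ℝ k B K) : ContDiffOn ℝ k (fun p => affineDrift (A p, B p)) K :=
  (hA.prodMk hB).continuousLinearMap_comp (affineDrift (E := E) (U := U))

lemma contDiffOn_quadraticCost {W : Type*} [NormedAddCommGroup W] [NormedSpace ℝ W] {K : Set W}
    {k : WithTop ℕ∞} {Q : W → ℝ} {S : W → U} {R : W → U →L[ℝ] U} (hQ : ContDiffOn ℝ k Q K)
    (hS : ContDiffOn ℝ k S K) (hR : ContDiffOn ℝ k R K) :
    ContDiffOn ℝ k (fun p => quadraticCost (Q p, S p, R p)) K :=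
  (hQ.prodMk (hS.prodMk hR)).continuousLinearMap_comp (quadraticCost (U := U))

lemma exists_lipschitzWith_clm_prodMk {F G : Type*} [NormedAddCommGroup F] [NormedSpace ℝ F]
    [NormedAddCommGroup G] [NormedSpace ℝ G] (M : E × F →L[ℝ] G) {K : Set ℝ} {A : ℝ → E → E}
    {B : ℝ → E → F}
    (hA : ∃ L, ∀ s ∈ K, ∀ x y, ‖A s x - A s y‖ ≤ L * ‖x - y‖)
    (hB : ∃ L, ∀ s ∈ K, ∀ x y, ‖B s x - B s y‖ ≤ L * ‖x - y‖) :
    ∃ L : NNReal, ∀ s ∈ K, LipschitzWith L fun x => M (A s x, B s x) := by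
  obtain ⟨LA, hA⟩ := hA
  obtain ⟨LB, hB⟩ := hB
  refine ⟨‖M‖₊ * max LA.toNNReal LB.toNNReal, fun s hs => ?_⟩
  have hlipA : LipschitzWith LA.toNNReal (A s) := .of_dist_le' fun x y => by
    simpa only [dist_eq_norm] using hA s hs x y
  have hlipB : LipschitzWith LB.toNNReal (B s) := .of_dist_le' fun x y => by
    simpa only [dist_eq_norm] using hB s hs x y
  exact M.lipschitz.comp (hlipA.prodMk hlipB)

lemma exists_lipschitzWith_affineDrift {K : Set ℝ} {A : ℝ → E → E} {B : ℝ → E → U →L[ℝ] E}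
    (hA : ∃ L, ∀ s ∈ K, ∀ x y, ‖A s x - A s y‖ ≤ L * ‖x - y‖)
    (hB : ∃ L, ∀ s ∈ K, ∀ x y, ‖B s x - B s y‖ ≤ L * ‖x - y‖) :
    ∃ L : NNReal, ∀ s ∈ K, LipschitzWith L fun x => affineDrift (A s x, B s x) :=
  exists_lipschitzWith_clm_prodMk (affineDrift (E := E) (U := U)) hA hB

variable {x : E}

lemma fderiv_affineDrift_apply {A : E → E} {B : E → U →L[ℝ] E} (hA : DifferentiableAt ℝ A x)
    (hB : DifferentiableAt ℝ B x) (z : E) (v : Monomials U) :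
    fderiv ℝ (fun y => affineDrift (A y, B y)) x z v =
      v.1 • fderiv ℝ A x z + fderiv ℝ B x z v.2.1 := by
  rw [fderiv_clm_comp_apply affineDrift (hA.prodMk hB), hA.fderiv_prodMk hB]
  rfl

lemma fderiv_fderiv_affineDrift_apply {A : E → E} {B : E → U →L[ℝ] E} (hA : ContDiff ℝ 2 A)
    (hB : ContDiff ℝ 2 B) (x a z : E) (v : Monomials U) :
    fderiv ℝ (fderiv ℝ fun y => affineDrift (A y, B y)) x a z v =
      v.1 • fderiv ℝ (fderiv ℝ A) x a z + fderiv ℝ (fderiv ℝ B) x a z v.2.1 := by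
  rw [fderiv_fderiv_clm_comp_apply affineDrift (hA.prodMk hB),
    fderiv_fderiv_prodMk_apply hA hB]
  rfl

lemma fderiv_quadraticCost_apply {Q : E → ℝ} {S : E → U} {R : E → U →L[ℝ] U}
    (hQ : DifferentiableAt ℝ Q x) (hS : DifferentiableAt ℝ S x) (hR : DifferentiableAt ℝ R x)
    (z : E) (v : Monomials U) :
    fderiv ℝ (fun y => quadraticCost (Q y, S y, R y)) x z v =
      v.1 * fderiv ℝ Q x z + (⟪fderiv ℝ S x z, v.2.1⟫_ℝ + 1 / 2 * v.2.2 (fderiv ℝ R x z)) := by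
  rw [fderiv_clm_comp_apply quadraticCost (hQ.prodMk (hS.prodMk hR)),
    hQ.fderiv_prodMk (hS.prodMk hR), hS.fderiv_prodMk hR]
  rfl

lemma fderiv_fderiv_quadraticCost_apply {Q : E → ℝ} {S : E → U} {R : E → U →L[ℝ] U}
    (hQ : ContDiff ℝ 2 Q) (hS : ContDiff ℝ 2 S) (hR : ContDiff ℝ 2 R) (x a z : E)
    (v : Monomials U) :
    fderiv ℝ (fderiv ℝ fun y => quadraticCost (Q y, S y, R y)) x a z v =
      v.1 * fderiv ℝ (fderiv ℝ Q) x a z + (⟪fderiv ℝ (fderiv ℝ S) x a z, v.2.1⟫_ℝ +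
        1 / 2 * v.2.2 (fderiv ℝ (fderiv ℝ R) x a z)) := by
  rw [fderiv_fderiv_clm_comp_apply quadraticCost (hQ.prodMk (hS.prodMk hR)),
    fderiv_fderiv_prodMk_apply hQ (hS.prodMk hR), fderiv_fderiv_prodMk_apply hS hR]
  rfl

end AffineQuadratic

end CurveSpace

namespace AQProblem

open CurveSpace

set_option maxSynthPendingDepth 3

/-! ### Affine-quadratic problems -/

section Coordinates

variable {k : ℕ}

lemma inner_eq_sum (y z : Rn k) : ⟪y, z⟫_ℝ = ∑ j, y j * z j := by
  simp [PiLp.inner_apply, mul_comm]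

lemma clm_apply_eq_sum {F : Type*} [NormedAddCommGroup F] [NormedSpace ℝ F] (M : Rn k →L[ℝ] F)
    (w : Rn k) : M w = ∑ j, w j • M (unitVec j) := by
  conv_lhs => rw [← (EuclideanSpace.basisFun (Fin k) ℝ).sum_repr w]
  simp [unitVec]

lemma inner_apply_self_eq_sum (M : Rn k →L[ℝ] Rn k) (w : Rn k) :
    ⟪M w, w⟫_ℝ = ∑ i, ∑ j, (w i * w j) * M (unitVec j) i := by
  rw [clm_apply_eq_sum M w, sum_inner, Finset.sum_comm]
  refine Finset.sum_congr rfl fun j _ => ?_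
  rw [inner_smul_left, inner_eq_sum, Finset.mul_sum]
  exact Finset.sum_congr rfl fun i _ => by simp; ring

end Coordinates

section Coefficients

variable {n m : ℕ} (P : AQProblem n m) {s : ℝ} {x : Rn n}

lemma inner_hess_coord {k : ℕ} {f : Rn n → Rn k} (hf : ContDiff ℝ 2 f) (i : Fin k)
    (x a z : Rn n) : ⟪hess (fun y => f y i) x a, z⟫_ℝ = fderiv ℝ (fderiv ℝ f) x a z i :=
  (inner_hess ((EuclideanSpace.proj (𝕜 := ℝ) i).contDiff.comp hf) x a z).trans
    (fderiv_fderiv_clm_comp_apply (EuclideanSpace.proj i) hf x a z)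

lemma fderiv_Bcol_apply (hB : DifferentiableAt ℝ (P.B s) x) (j : Fin m) (z : Rn n) :
    fderiv ℝ (P.Bcol j s) x z = fderiv ℝ (P.B s) x z (unitVec j) :=
  fderiv_clm_comp_apply (.apply ℝ _ (unitVec j)) hB z

lemma fderiv_Rcol_apply (hR : DifferentiableAt ℝ (P.R s) x) (j : Fin m) (z : Rn n) :
    fderiv ℝ (P.Rcol j s) x z = fderiv ℝ (P.R s) x z (unitVec j) :=
  fderiv_clm_comp_apply (.apply ℝ _ (unitVec j)) hR z

lemma fderiv_Brow_apply (hB : DifferentiableAt ℝ (P.B s) x) (i : Fin n) (z : Rn n) :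
    fderiv ℝ (P.Brow i s) x z = ((fderiv ℝ (P.B s) x z)†) (unitVec i) :=
  fderiv_clm_comp_apply (.apply ℝ _ (unitVec i) ∘L adjointL) hB z

lemma coefA_apply {u : ℝ → Rn m} {X : ℝ → Rn n} (hB : DifferentiableAt ℝ (P.B s) (X s))
    (z : Rn n) :
    P.coefA u X s z = fderiv ℝ (P.A s) (X s) z + fderiv ℝ (P.B s) (X s) z (u s) := by
  rw [clm_apply_eq_sum (fderiv ℝ (P.B s) (X s) z)]
  simp [coefA, fderiv_Bcol_apply P hB]

lemma coefC_apply {u : ℝ → Rn m} {X Y : ℝ → Rn n} (hB : DifferentiableAt ℝ (P.B s) (X s))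
    (hR : DifferentiableAt ℝ (P.R s) (X s)) (z : Rn n) :
    P.coefC u X Y s z = fderiv ℝ (P.R s) (X s) z (u s) + fderiv ℝ (P.S s) (X s) z +
      ((fderiv ℝ (P.B s) (X s) z)†) (Y s) := by
  rw [clm_apply_eq_sum (fderiv ℝ (P.R s) (X s) z), clm_apply_eq_sum (_†)]
  simp [coefC, fderiv_Rcol_apply P hR, fderiv_Brow_apply P hB]

lemma inner_gradient_Rent (hR : DifferentiableAt ℝ (P.R s) x) (j k : Fin m) (z : Rn n) :
    ⟪∇ (P.Rent j k s) x, z⟫_ℝ = fderiv ℝ (P.R s) x z (unitVec k) j := by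
  rw [gradient_eq_riesz, inner_riesz]
  exact fderiv_clm_comp_apply (EuclideanSpace.proj j ∘L .apply ℝ _ (unitVec k)) hR z

lemma inner_hess_entry {k l : ℕ} {M : Rn n → Rn k →L[ℝ] Rn l} (hM : ContDiff ℝ 2 M) (i : Fin l)
    (j : Fin k) (x a z : Rn n) :
    ⟪hess (fun y => M y (unitVec j) i) x a, z⟫_ℝ =
      fderiv ℝ (fderiv ℝ M) x a z (unitVec j) i :=
  (inner_hess ((EuclideanSpace.proj (𝕜 := ℝ) i ∘L .apply ℝ _ (unitVec j)).contDiff.comp hM)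
    x a z).trans (fderiv_fderiv_clm_comp_apply
      (EuclideanSpace.proj i ∘L .apply ℝ _ (unitVec j)) hM x a z)

lemma inner_hess_Rent (hR : ContDiff ℝ 2 (P.R s)) (j k : Fin m) (x a z : Rn n) :
    ⟪hess (P.Rent j k s) x a, z⟫_ℝ = fderiv ℝ (fderiv ℝ (P.R s)) x a z (unitVec k) j :=
  inner_hess_entry hR j k x a z

lemma inner_hess_Bcol (hB : ContDiff ℝ 2 (P.B s)) (i : Fin n) (j : Fin m) (x a z : Rn n) :
    ⟪hess (fun y => P.Bcol j s y i) x a, z⟫_ℝ =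
      fderiv ℝ (fderiv ℝ (P.B s)) x a z (unitVec j) i :=
  inner_hess_entry hB i j x a z

lemma inner_coefA₁_apply {u : ℝ → Rn m} {X Y : ℝ → Rn n} (hA : ContDiff ℝ 2 (P.A s))
    (hB : ContDiff ℝ 2 (P.B s)) (hQ : ContDiff ℝ 2 (P.Q s)) (hS : ContDiff ℝ 2 (P.S s))
    (hR : ContDiff ℝ 2 (P.R s)) (a z : Rn n) :
    ⟪P.coefA₁ u X Y s a, z⟫_ℝ = ⟪Y s, fderiv ℝ (fderiv ℝ (P.A s)) (X s) a z⟫_ℝ +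
      fderiv ℝ (fderiv ℝ (P.Q s)) (X s) a z +
      1 / 2 * ⟪fderiv ℝ (fderiv ℝ (P.R s)) (X s) a z (u s), u s⟫_ℝ +
      (⟪Y s, fderiv ℝ (fderiv ℝ (P.B s)) (X s) a z (u s)⟫_ℝ +
        ⟪fderiv ℝ (fderiv ℝ (P.S s)) (X s) a z, u s⟫_ℝ) := by
  have hBsum : ⟪Y s, fderiv ℝ (fderiv ℝ (P.B s)) (X s) a z (u s)⟫_ℝ =
      ∑ j, u s j * ∑ i, Y s i * fderiv ℝ (fderiv ℝ (P.B s)) (X s) a z (unitVec j) i := by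
    rw [clm_apply_eq_sum _ (u s), inner_sum]
    simp only [inner_smul_right, inner_eq_sum]
  rw [hBsum, inner_apply_self_eq_sum, inner_eq_sum (Y s), inner_eq_sum _ (u s)]
  simp [coefA₁, inner_add_left, sum_inner, inner_smul_left, inner_hess_coord hA,
    inner_hess hQ, inner_hess_coord hS, inner_hess_Rent P hR, inner_hess_Bcol P hB,
    Finset.sum_add_distrib, mul_comm]

end Coefficients

variable {n m : ℕ} {P : AQProblem n m}

variable (P) in
/-- The assumptions under which the derivatives of the cost exist: smooth coefficients, globally
Lipschitz dynamics and symmetric `R`, on a nondegenerate horizon. -/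
structure IsRegular : Prop extends P.H3 where
  pos : 0 < P.T
  lipA : ∃ L, ∀ s ∈ Icc 0 P.T, ∀ x y, ‖P.A s x - P.A s y‖ ≤ L * ‖x - y‖
  lipB : ∃ L, ∀ s ∈ Icc 0 P.T, ∀ x y, ‖P.B s x - P.B s y‖ ≤ L * ‖x - y‖
  symmR : ∀ s ∈ Icc 0 P.T, ∀ x, IsSelfAdjoint (P.R s x)

namespace IsRegular

variable {t : ℝ}

/-- The affine-quadratic problem as a problem that is linear in the monomials of the control. -/
noncomputable def toSystem (hP : P.IsRegular) (h0 : 0 ≤ t) :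
    ControlSystem t P.T (Rn n) (Monomials (Rn m)) where
  f s x := affineDrift (P.A s x, P.B s x)
  c s x := quadraticCost (P.Q s x, P.S s x, P.R s x)
  G := P.G
  horizon := Icc 0 P.T
  uniqueDiffOn_horizon := uniqueDiffOn_Icc hP.pos
  Icc_subset_horizon := Icc_subset_Icc_left h0
  contDiffOn_f := contDiffOn_affineDrift hP.smoothA hP.smoothB
  contDiffOn_c := contDiffOn_quadraticCost hP.smoothQ hP.smoothS hP.smoothR
  contDiff_G := hP.smoothG
  L := (exists_lipschitzWith_affineDrift hP.lipA hP.lipB).choose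
  lipschitz_f s hs := (exists_lipschitzWith_affineDrift hP.lipA hP.lipB).choose_spec s
    (Icc_subset_Icc_left h0 hs)

variable (hP : P.IsRegular) (h0 : 0 ≤ t) {s : ℝ}

lemma toSystem_f_monomials (s : ℝ) (x : Rn n) (w : Rn m) :
    (hP.toSystem h0).f s x (monomials w) = P.A s x + P.B s x w := by
  simp [toSystem, monomials]

lemma toSystem_f_monomialsDeriv (s : ℝ) (x : Rn n) (w v : Rn m) :
    (hP.toSystem h0).f s x (monomialsDeriv w v) = P.B s x v := by
  simp [toSystem, monomialsDeriv]

lemma toSystem_c_monomials (s : ℝ) (X : ℝ → Rn n) (u : ℝ → Rn m) :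
    (hP.toSystem h0).c s (X s) (monomials (u s)) = P.runningCost u X s := by
  simp [toSystem, monomials, runningCost, add_assoc]

include hP in
lemma isSelfAdjoint_fderiv_R (hs : s ∈ Icc 0 P.T) (x z : Rn n) :
    IsSelfAdjoint (fderiv ℝ (P.R s) x z) := by
  have hR : Differentiable ℝ (P.R s) :=
    (contDiff_of_contDiffOn hP.smoothR hs).differentiable two_ne_zero
  have h := fderiv_clm_comp_apply adjointL (hR x) z
  simp only [adjointL_apply, (hP.symmR s hs _).adjoint_eq] at h
  exact h.symm

lemma fderiv_drift_apply (hs : s ∈ Icc 0 P.T) (x z : Rn n) (v : Monomials (Rn m)) :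
    fderiv ℝ ((hP.toSystem h0).f s) x z v =
      v.1 • fderiv ℝ (P.A s) x z + fderiv ℝ (P.B s) x z v.2.1 :=
  fderiv_affineDrift_apply
    ((contDiff_of_contDiffOn hP.smoothA hs).differentiable two_ne_zero x)
    ((contDiff_of_contDiffOn hP.smoothB hs).differentiable two_ne_zero x) z v

lemma fderiv_runningCost_apply (hs : s ∈ Icc 0 P.T) (x z : Rn n) (v : Monomials (Rn m)) :
    fderiv ℝ ((hP.toSystem h0).c s) x z v = v.1 * fderiv ℝ (P.Q s) x z +
      (⟪fderiv ℝ (P.S s) x z, v.2.1⟫_ℝ + 1 / 2 * v.2.2 (fderiv ℝ (P.R s) x z)) :=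
  fderiv_quadraticCost_apply
    ((contDiff_of_contDiffOn hP.smoothQ hs).differentiable two_ne_zero x)
    ((contDiff_of_contDiffOn hP.smoothS hs).differentiable two_ne_zero x)
    ((contDiff_of_contDiffOn hP.smoothR hs).differentiable two_ne_zero x) z v

lemma fderiv_toSystem_f_monomials (hs : s ∈ Icc 0 P.T) (u : ℝ → Rn m) (X : ℝ → Rn n)
    (z : Rn n) :
    fderiv ℝ ((hP.toSystem h0).f s) (X s) z (monomials (u s)) = P.coefA u X s z := by
  rw [hP.fderiv_drift_apply h0 hs, P.coefA_apply
    ((contDiff_of_contDiffOn hP.smoothB hs).differentiable two_ne_zero _)]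
  simp [monomials]

lemma costateField_monomials (hs : s ∈ Icc 0 P.T) (u : ℝ → Rn m) (X Y : ℝ → Rn n) :
    (hP.toSystem h0).costateField s (X s, Y s) (monomials (u s)) =
      -((P.coefA u X s)†) (Y s) - ∇ (P.Q s) (X s) - ((fderiv ℝ (P.S s) (X s))†) (u s)
        - (1 / 2 : ℝ) • ∑ j, ∑ k, (u s j * u s k) • ∇ (P.Rent j k s) (X s) := by
  have hR : DifferentiableAt ℝ (P.R s) (X s) :=
    (contDiff_of_contDiffOn hP.smoothR hs).differentiable two_ne_zero _
  refine ext_inner_right ℝ fun z => ?_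
  rw [ControlSystem.inner_costateField, hP.fderiv_runningCost_apply h0 hs,
    hP.fderiv_toSystem_f_monomials h0 hs]
  simp only [inner_sub_left, inner_neg_left, inner_smul_left, sum_inner,
    ContinuousLinearMap.adjoint_inner_left, P.inner_gradient_Rent hR, gradient_eq_riesz (P.Q s),
    inner_riesz, real_inner_comm _ (u s), monomials, tensorForm_apply, inner_apply_self_eq_sum]
  simp
  ring

lemma linearizedCostateField (hs : s ∈ Icc t P.T) (u v : ℝ → Rn m) (X Y : ℝ → Rn n)
    (x₁ y₁ : Rn n) :
    (hP.toSystem h0).costateField s (X s, Y s) (monomialsDeriv (u s) (v s)) +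
        fderiv ℝ ((hP.toSystem h0).costateField s) (X s, Y s) (x₁, y₁) (monomials (u s)) =
      -P.coefA₁ u X Y s x₁ - ((P.coefA u X s)†) y₁ - ((P.coefC u X Y s)†) (v s) := by
  have hs0 : s ∈ Icc 0 P.T := Icc_subset_Icc_left h0 hs
  have hA := contDiff_of_contDiffOn hP.smoothA hs0
  have hB := contDiff_of_contDiffOn hP.smoothB hs0
  have hQ := contDiff_of_contDiffOn hP.smoothQ hs0
  have hS := contDiff_of_contDiffOn hP.smoothS hs0
  have hR := contDiff_of_contDiffOn hP.smoothR hs0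
  refine ext_inner_right ℝ fun z => ?_
  have hsymm : ⟪fderiv ℝ (P.R s) (X s) z (v s), u s⟫_ℝ =
      ⟪fderiv ℝ (P.R s) (X s) z (u s), v s⟫_ℝ := by
    rw [real_inner_comm]
    exact ((hP.isSelfAdjoint_fderiv_R hs0 (X s) z).isSymmetric (u s) (v s)).symm
  have hf₂ : fderiv ℝ (fderiv ℝ ((hP.toSystem h0).f s)) (X s) x₁ z (monomials (u s)) = _ :=
    fderiv_fderiv_affineDrift_apply hA hB (X s) x₁ z _
  have hc₂ : fderiv ℝ (fderiv ℝ ((hP.toSystem h0).c s)) (X s) x₁ z (monomials (u s)) = _ :=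
    fderiv_fderiv_quadraticCost_apply hQ hS hR (X s) x₁ z _
  rw [inner_add_left, ControlSystem.inner_costateField,
    ControlSystem.inner_fderiv_costateField _ hs, hf₂, hc₂,
    hP.fderiv_toSystem_f_monomials h0 hs0, hP.fderiv_drift_apply h0 hs0,
    hP.fderiv_runningCost_apply h0 hs0]
  simp only [inner_sub_left, inner_neg_left, ContinuousLinearMap.adjoint_inner_left,
    P.inner_coefA₁_apply hA hB hQ hS hR, P.coefC_apply (hB.differentiable two_ne_zero _)
      (hR.differentiable two_ne_zero _), inner_add_right, monomials, monomialsDeriv]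
  simp [hsymm, real_inner_comm _ (v s), ContinuousLinearMap.adjoint_inner_left]
  ring

section Trajectories

variable {t : ℝ} [hT : Fact (t ≤ P.T)] (hP : P.IsRegular) (h0 : 0 ≤ t)

section Linearized

variable {u v : Control m t P.T} {δ : LpOn 1 t P.T (Monomials (Rn m))}
  {X Y Z₀ Z₁ : C(Icc t P.T, Rn n)}

lemma linearizedState_iff
    (hδ : δ =ᵐ[volume.restrict (Icc t P.T)] fun s => monomialsDeriv (u s) (v s))
    (hZ₁ : ∀ Z, Z = primitive left (applyLp 1 ((hP.toSystem h0).isC1_f.along X) δ +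
        applyLp 1 (pointwiseApply ((hP.toSystem h0).isC1_f.fderivAlong X) Z) (monomialsLp u)) ↔
      Z = Z₁) (X₁ : ℝ → Rn n) :
    SolvesODE t P.T X₁ (fun s => P.coefA u (extend X) s (X₁ s) + P.B s (extend X s) (v s)) ∧
        X₁ t = 0 ↔
      EqOn X₁ (extend Z₁) (Icc t P.T) := by
  let F (s : ℝ) (y : Rn n) : Rn n := P.coefA u (extend X) s y + P.B s (extend X s) (v s)
  refine solvesODE_iff_of_volterra (F := F) (a := left) (fun Z => ?_)
    (fun Z => by rw [map_zero, zero_add]; exact hZ₁ Z)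
  have hf := (hP.toSystem h0).isC1_f
  filter_upwards [Lp.coeFn_add (applyLp 1 (hf.along X) δ)
      (applyLp 1 (pointwiseApply (hf.fderivAlong X) Z) (monomialsLp u)),
    hf.coeFn_applyLp_along 1 X δ, hf.coeFn_applyLp_fderivAlong 1 X Z (monomialsLp u), hδ,
    coeFn_monomialsLp u, ae_restrict_mem measurableSet_Icc] with s hadd hB hA hδs hu hs
  rw [hadd, Pi.add_apply, hB, hA, hδs, hu, toSystem_f_monomialsDeriv,
    fderiv_toSystem_f_monomials hP h0 (Icc_subset_Icc_left h0 hs), add_comm]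

lemma linearizedAdjoint_iff
    (hδ : δ =ᵐ[volume.restrict (Icc t P.T)] fun s => monomialsDeriv (u s) (v s))
    {X₁ : ℝ → Rn n} (hX₁ : EqOn X₁ (extend Z₀) (Icc t P.T))
    (hZ₁ : ∀ Z, Z = constCurve (hess P.G (X right) (Z₀ right)) +
        primitive right (applyLp 1 ((hP.toSystem h0).isC1_costateField.along
            (curvePair (X, Y))) δ +
          applyLp 1 (pointwiseApply ((hP.toSystem h0).isC1_costateField.fderivAlong
            (curvePair (X, Y))) (curvePair (Z₀, Z))) (monomialsLp u)) ↔
      Z = Z₁) (Y₁ : ℝ → Rn n) :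
    SolvesODE t P.T Y₁ (fun s => -P.coefA₁ u (extend X) (extend Y) s (X₁ s) -
        ((P.coefA u (extend X) s)†) (Y₁ s) - ((P.coefC u (extend X) (extend Y) s)†) (v s)) ∧
        Y₁ P.T = hess P.G (extend X P.T) (X₁ P.T) ↔
      EqOn Y₁ (extend Z₁) (Icc t P.T) := by
  rw [hX₁ ⟨hT.out, le_rfl⟩, extend_of_mem _ ⟨hT.out, le_rfl⟩, extend_of_mem _ ⟨hT.out, le_rfl⟩]
  let F (s : ℝ) (y : Rn n) : Rn n := -P.coefA₁ u (extend X) (extend Y) s (X₁ s) -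
    ((P.coefA u (extend X) s)†) y - ((P.coefC u (extend X) (extend Y) s)†) (v s)
  refine solvesODE_iff_of_volterra (F := F) (a := right) (fun Z => ?_) hZ₁
  have hfield := (hP.toSystem h0).isC1_costateField
  filter_upwards [Lp.coeFn_add (applyLp 1 (hfield.along (curvePair (X, Y))) δ)
      (applyLp 1 (pointwiseApply (hfield.fderivAlong (curvePair (X, Y))) (curvePair (Z₀, Z)))
        (monomialsLp u)),
    hfield.coeFn_applyLp_along 1 (curvePair (X, Y)) δ,
    hfield.coeFn_applyLp_fderivAlong 1 (curvePair (X, Y)) (curvePair (Z₀, Z)) (monomialsLp u),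
    hδ, coeFn_monomialsLp u, ae_restrict_mem measurableSet_Icc] with s hadd hB hA hδs hu hs
  rw [hadd, Pi.add_apply, hB, hA, hδs, hu, extend_curvePair, extend_curvePair]
  refine (hP.linearizedCostateField h0 hs u v _ _ _ _).trans ?_
  rw [← hX₁ hs]

end Linearized

/-- The state trajectory of a control, as a curve. -/
noncomputable def stateCurve (x : Rn n) (u : Control m t P.T) : C(Icc t P.T, Rn n) :=
  (hP.toSystem h0).trajectory x (monomialsLp u)

/-- The adjoint trajectory of a control, as a curve. -/
noncomputable def adjointCurve (x : Rn n) (u : Control m t P.T) : C(Icc t P.T, Rn n) :=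
  (hP.toSystem h0).costate x (monomialsLp u)

variable (x : Rn n) (u : Control m t P.T)

lemma isState_iff (X : ℝ → Rn n) :
    P.IsState t x u X ↔ EqOn X (extend (hP.stateCurve h0 x u)) (Icc t P.T) := by
  refine solvesODE_iff_of_volterra (F := fun s y => P.A s y + P.B s y (u s)) (a := left)
    (fun Z => ?_) ((hP.toSystem h0).eq_trajectory_iff x (monomialsLp u))
  filter_upwards [(hP.toSystem h0).isC1_f.coeFn_applyLp_along 1 Z (monomialsLp u),
    coeFn_monomialsLp u] with s hf hu
  rw [hf, hu, toSystem_f_monomials]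

lemma isStateAdjoint_iff (X Y : ℝ → Rn n) :
    P.IsStateAdjoint t x u X Y ↔ EqOn X (extend (hP.stateCurve h0 x u)) (Icc t P.T) ∧
      EqOn Y (extend (hP.adjointCurve h0 x u)) (Icc t P.T) := by
  let F (s : ℝ) (y : Rn n) : Rn n := -((P.coefA u X s)†) y - ∇ (P.Q s) (X s) -
    ((fderiv ℝ (P.S s) (X s))†) (u s) -
    (1 / 2 : ℝ) • ∑ j, ∑ k, (u s j * u s k) • ∇ (P.Rent j k s) (X s)
  have hadjoint (hX : EqOn X (extend (hP.stateCurve h0 x u)) (Icc t P.T)) :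
      SolvesODE t P.T Y (fun s => F s (Y s)) ∧ Y P.T = ∇ P.G (X P.T) ↔
        EqOn Y (extend (hP.adjointCurve h0 x u)) (Icc t P.T) := by
    rw [hX ⟨hT.out, le_rfl⟩, extend_of_mem _ ⟨hT.out, le_rfl⟩]
    refine solvesODE_iff_of_volterra (a := right) (fun Z => ?_)
      ((hP.toSystem h0).eq_costate_iff x (monomialsLp u))
    filter_upwards [(hP.toSystem h0).isC1_costateField.coeFn_applyLp_along 1
        (curvePair (hP.stateCurve h0 x u, Z)) (monomialsLp u), coeFn_monomialsLp u,
      ae_restrict_mem measurableSet_Icc] with s hfield hu hs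
    refine hfield.trans ?_
    rw [hu, extend_curvePair, ← hX hs]
    exact hP.costateField_monomials h0 (Icc_subset_Icc_left h0 hs) u X (extend Z)
  constructor
  · intro h
    have hX := (hP.isState_iff h0 x u X).1 h.state
    exact ⟨hX, (hadjoint hX).1 ⟨h.adjoint, h.terminal⟩⟩
  · rintro ⟨hX, hY⟩
    have h := (hadjoint hX).2 hY
    exact ⟨(hP.isState_iff h0 x u X).2 hX, h.1, h.2⟩

lemma exists_hasStrictFDerivAt_stateCurve_adjointCurve :
    ∃ X' Y' : Control m t P.T →L[ℝ] C(Icc t P.T, Rn n),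
      HasStrictFDerivAt (hP.stateCurve h0 x) X' u ∧
      HasStrictFDerivAt (hP.adjointCurve h0 x) Y' u ∧
      ∀ v X₁ Y₁, P.IsLinearized t u (extend (hP.stateCurve h0 x u))
          (extend (hP.adjointCurve h0 x u)) v X₁ Y₁ ↔
        EqOn X₁ (extend (X' v)) (Icc t P.T) ∧ EqOn Y₁ (extend (Y' v)) (Icc t P.T) := by
  obtain ⟨q', hq', hq'v⟩ := exists_hasStrictFDerivAt_monomialsLp u
  obtain ⟨X', hX', hX₁⟩ :=
    (hP.toSystem h0).exists_hasStrictFDerivAt_trajectory x (monomialsLp u)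
  obtain ⟨Y', hY', hY₁⟩ :=
    (hP.toSystem h0).exists_hasStrictFDerivAt_costate x (monomialsLp u) hX'
  refine ⟨X' ∘L q', Y' ∘L q', hX'.comp u hq', hY'.comp u hq', fun v X₁ Y₁ => ?_⟩
  have hstate := hP.linearizedState_iff h0 (hq'v v) (hX₁ (q' v)) X₁
  have hadjoint (h : EqOn X₁ (extend (X' (q' v))) (Icc t P.T)) :=
    hP.linearizedAdjoint_iff h0 (hq'v v) h (hY₁ (q' v)) Y₁
  constructor
  · intro h
    have hX := hstate.1 ⟨h.forward, h.initial⟩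
    exact ⟨hX, (hadjoint hX).1 ⟨h.backward, h.terminal⟩⟩
  · rintro ⟨hX, hY⟩
    have h₁ := hstate.2 hX
    have h₂ := (hadjoint hX).2 hY
    exact ⟨h₁.1, h₂.1, h₁.2, h₂.2⟩

end Trajectories
end IsRegular

variable (P) in
/-- The part `S(s, x) + B(s, x)ᵀ y` of the control gradient `R w + S + Bᵀ y` of the Hamiltonian at
`p = (x, y)` that is constant in the control value `w`. -/
noncomputable def gradientOffset (s : ℝ) (p : Rn n × Rn n) : Rn m :=
  P.S s p.1 + adjointL (P.B s p.1) p.2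

namespace IsRegular

variable {t : ℝ} [hT : Fact (t ≤ P.T)] (hP : P.IsRegular) (h0 : 0 ≤ t)

section Cost

variable (x : Rn n) (u : Control m t P.T)

lemma runningCost_ae_eq (X : C(Icc t P.T, Rn n)) :
    P.runningCost u (extend X) =ᵐ[volume.restrict (Icc t P.T)]
      applyLp 1 ((hP.toSystem h0).isC1_c.along X) (monomialsLp u) := by
  filter_upwards [(hP.toSystem h0).isC1_c.coeFn_applyLp_along 1 X (monomialsLp u),
    coeFn_monomialsLp u] with s hc hu
  rw [hc, hu, toSystem_c_monomials]

include hP h0 in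
lemma intervalIntegrable_runningCost (X : C(Icc t P.T, Rn n)) :
    IntervalIntegrable (P.runningCost u (extend X)) volume t P.T :=
  intervalIntegrable_of_integrable
    ((L1.integrable_coeFn _).congr (hP.runningCost_ae_eq h0 u X).symm) left right

lemma state_eqOn : EqOn (P.state t x u) (extend (hP.stateCurve h0 x u)) (Icc t P.T) := by
  have h : ∃ X, P.IsState t x u X := ⟨_, (hP.isState_iff h0 x u _).2 (eqOn_refl _ _)⟩
  rw [state, dif_pos h]
  exact (hP.isState_iff h0 x u _).1 h.choose_spec

lemma J_eq_cost : P.J t x u = (hP.toSystem h0).cost x (monomialsLp u) := by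
  have hstate := hP.state_eqOn h0 x u
  have hcongr : EqOn (P.runningCost u (P.state t x u))
      (P.runningCost u (extend (hP.stateCurve h0 x u))) (uIcc t P.T) := fun s hs => by
    rw [uIcc_of_le hT.out] at hs
    simp only [runningCost, hstate hs]
  rw [J, intervalIntegral.integral_congr hcongr, hstate ⟨hT.out, le_rfl⟩, extend_of_mem]
  exact congrArg (· + _)
    (intervalIntegral_congr_of_ae (hP.runningCost_ae_eq h0 u _) left right)

end Cost

section Gradient

omit hT
include hP h0

lemma isC1_R : IsC1 t P.T P.R :=
  isC1_of_contDiffOn (uniqueDiffOn_Icc hP.pos) (Icc_subset_Icc_left h0)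
    (hP.smoothR.of_le one_le_two)

lemma isC1_gradientOffset : IsC1 t P.T P.gradientOffset := by
  refine isC1_of_contDiffOn (uniqueDiffOn_Icc hP.pos) (Icc_subset_Icc_left h0) ?_
  have hproj : ContDiffOn ℝ 1 (fun p : ℝ × Rn n × Rn n => (p.1, p.2.1)) (Icc 0 P.T ×ˢ univ) := by
    fun_prop
  have hmaps : MapsTo (fun p : ℝ × Rn n × Rn n => (p.1, p.2.1)) (Icc 0 P.T ×ˢ univ)
      (Icc 0 P.T ×ˢ univ) := fun p hp => ⟨hp.1, mem_univ _⟩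
  have hS := (hP.smoothS.of_le one_le_two).comp hproj hmaps
  have hB := (hP.smoothB.of_le one_le_two).comp hproj hmaps
  have hadjoint : ContDiffOn ℝ 1 (fun p : ℝ × Rn n × Rn n => adjointL (P.B p.1 p.2.1))
      (Icc 0 P.T ×ˢ univ) :=
    (adjointL (E := Rn m) (F := Rn n)).contDiff.comp_contDiffOn hB
  exact hS.add (hadjoint.clm_apply contDiff_snd.snd.contDiffOn)

lemma fderiv_gradientOffset {s : ℝ} (hs : s ∈ Icc t P.T) (x y x₁ y₁ : Rn n) :
    fderiv ℝ (P.gradientOffset s) (x, y) (x₁, y₁) = fderiv ℝ (P.S s) x x₁ +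
      (((P.B s x)†) y₁ + ((fderiv ℝ (P.B s) x x₁)†) y) := by
  have hs0 : s ∈ Icc 0 P.T := Icc_subset_Icc_left h0 hs
  have hS := ((contDiff_of_contDiffOn hP.smoothS hs0).differentiable two_ne_zero x).hasFDerivAt
  have hB := ((contDiff_of_contDiffOn hP.smoothB hs0).differentiable two_ne_zero x).hasFDerivAt
  have hadjoint : HasFDerivAt (fun p : Rn n × Rn n => adjointL (P.B s p.1)) _ (x, y) :=
    (adjointL (E := Rn m) (F := Rn n)).hasFDerivAt.comp (x, y) (hB.comp (x, y) hasFDerivAt_fst)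
  have h : HasFDerivAt (P.gradientOffset s) _ (x, y) :=
    (hS.comp (x, y) hasFDerivAt_fst).add (hadjoint.clm_apply hasFDerivAt_snd)
  rw [h.fderiv]
  rfl

end Gradient

/-- The gradient `R u + S + Bᵀ Y` of the cost at the control `u` with state curve `X` and adjoint
curve `Y`, as a control. -/
noncomputable def costGradient (u : Control m t P.T) (X Y : C(Icc t P.T, Rn n)) :
    Control m t P.T :=
  curveToLp 2 ((hP.isC1_gradientOffset h0).along (curvePair (X, Y))) +
    applyLp 2 ((hP.isC1_R h0).along X) u

lemma coeFn_costGradient (u : Control m t P.T) (X Y : C(Icc t P.T, Rn n)) :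
    hP.costGradient h0 u X Y =ᵐ[volume.restrict (Icc t P.T)] fun s =>
      P.R s (extend X s) (u s) + P.S s (extend X s) + ((P.B s (extend X s))†) (extend Y s) := by
  have hG := hP.isC1_gradientOffset h0
  filter_upwards [Lp.coeFn_add (curveToLp 2 (hG.along (curvePair (X, Y))))
      (applyLp 2 ((hP.isC1_R h0).along X) u),
    coeFn_curveToLp 2 (hG.along (curvePair (X, Y))),
    (hP.isC1_R h0).coeFn_applyLp_along 2 X u, ae_restrict_mem measurableSet_Icc]
    with s hadd hoffset hR hs
  rw [costGradient, hadd, Pi.add_apply, hoffset, hR, hG.extend_along _ hs, extend_curvePair,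
    add_assoc, add_comm]
  rfl

/-- The derivative `R v + Bᵀ Y₁ + 𝐂 X₁` of the cost gradient in the direction `v`, as a control;
`X₁` and `Y₁` are the derivatives of `X` and `Y`. -/
noncomputable def costGradientDeriv (u : Control m t P.T) (X Y : C(Icc t P.T, Rn n))
    (v : Control m t P.T) (X₁ Y₁ : C(Icc t P.T, Rn n)) : Control m t P.T :=
  curveToLp 2 (pointwiseApply ((hP.isC1_gradientOffset h0).fderivAlong (curvePair (X, Y)))
      (curvePair (X₁, Y₁))) +
    (applyLp 2 ((hP.isC1_R h0).along X) v +
      applyLp 2 (pointwiseApply ((hP.isC1_R h0).fderivAlong X) X₁) u)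

lemma coeFn_costGradientDeriv (u : Control m t P.T) (X Y : C(Icc t P.T, Rn n))
    (v : Control m t P.T) (X₁ Y₁ : C(Icc t P.T, Rn n)) :
    hP.costGradientDeriv h0 u X Y v X₁ Y₁ =ᵐ[volume.restrict (Icc t P.T)] fun s =>
      P.R s (extend X s) (v s) + ((P.B s (extend X s))†) (extend Y₁ s) +
        P.coefC u (extend X) (extend Y) s (extend X₁ s) := by
  have hG := hP.isC1_gradientOffset h0
  have hR := hP.isC1_R h0
  set dG := pointwiseApply (hG.fderivAlong (curvePair (X, Y))) (curvePair (X₁, Y₁)) with hdG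
  set dR := applyLp 2 (pointwiseApply (hR.fderivAlong X) X₁) u
  filter_upwards [Lp.coeFn_add (curveToLp 2 dG) (applyLp 2 (hR.along X) v + dR),
    Lp.coeFn_add (applyLp 2 (hR.along X) v) dR, coeFn_curveToLp 2 dG,
    hR.coeFn_applyLp_along 2 X v, hR.coeFn_applyLp_fderivAlong 2 X X₁ u,
    ae_restrict_mem measurableSet_Icc] with s hadd hadd' hdGs hRv hdRs hs
  have hs0 := Icc_subset_Icc_left h0 hs
  rw [costGradientDeriv, hadd, Pi.add_apply, hadd', Pi.add_apply, hdGs, hRv, hdRs, P.coefC_apply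
    ((contDiff_of_contDiffOn hP.smoothB hs0).differentiable two_ne_zero _)
    ((contDiff_of_contDiffOn hP.smoothR hs0).differentiable two_ne_zero _)]
  simp only [hdG, extend_of_mem _ hs, pointwiseApply_apply, IsC1.fderivAlong_apply,
    curvePair_apply, hP.fderiv_gradientOffset h0 hs]
  abel

section Differentiability

variable (x : Rn n) (u : Control m t P.T)

lemma exists_hasFDerivAt_costGradient {X' Y' : Control m t P.T →L[ℝ] C(Icc t P.T, Rn n)}
    (hX' : HasStrictFDerivAt (hP.stateCurve h0 x) X' u)
    (hY' : HasStrictFDerivAt (hP.adjointCurve h0 x) Y' u) :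
    ∃ D : Control m t P.T →L[ℝ] Control m t P.T,
      HasFDerivAt (fun w => hP.costGradient h0 w (hP.stateCurve h0 x w) (hP.adjointCurve h0 x w))
        D u ∧
      ∀ v, D v = hP.costGradientDeriv h0 u (hP.stateCurve h0 x u) (hP.adjointCurve h0 x u) v
        (X' v) (Y' v) := by
  have hpair : HasStrictFDerivAt
      (fun w => curvePair (hP.stateCurve h0 x w, hP.adjointCurve h0 x w)) _ u :=
    (curvePair (K := Icc t P.T) (E := Rn n) (F := Rn n)).hasStrictFDerivAt.comp u
      (hX'.prodMk hY')
  have hoffset := (curveToLp 2).hasStrictFDerivAt.comp u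
    (((hP.isC1_gradientOffset h0).hasStrictFDerivAt_along _).comp u hpair)
  have hR := (applyLp 2).hasStrictFDerivAt_of_bilinear
    (((hP.isC1_R h0).hasStrictFDerivAt_along (hP.stateCurve h0 x u)).comp u hX')
    (hasStrictFDerivAt_id u)
  exact ⟨_, (hoffset.add hR).hasFDerivAt, fun v => rfl⟩

omit hT in
lemma hamiltonian_monomialsDeriv {s : ℝ} (hs : s ∈ Icc 0 P.T) (x y : Rn n) (w v : Rn m) :
    (hP.toSystem h0).hamiltonian s y x (monomialsDeriv w v) =
      ⟪P.R s x w + P.S s x + ((P.B s x)†) y, v⟫_ℝ := by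
  have hsymm : ⟪P.R s x v, w⟫_ℝ = ⟪P.R s x w, v⟫_ℝ := by
    rw [real_inner_comm]
    exact ((hP.symmR s hs x).isSymmetric w v).symm
  rw [ControlSystem.hamiltonian_apply, toSystem_f_monomialsDeriv]
  simp only [inner_add_left, ContinuousLinearMap.adjoint_inner_left, toSystem, monomialsDeriv,
    quadraticCost_apply, add_apply, tensorForm_apply, hsymm]
  ring

lemma hasGradientAt_J : HasGradientAt (P.J t x)
    (hP.costGradient h0 u (hP.stateCurve h0 x u) (hP.adjointCurve h0 x u)) u := by
  obtain ⟨q', hq', hq'v⟩ := exists_hasStrictFDerivAt_monomialsLp u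
  rw [funext (hP.J_eq_cost h0 x)]
  refine (((hP.toSystem h0).hasStrictFDerivAt_cost x (monomialsLp u)).comp u
    hq').hasFDerivAt.congr_fderiv (ContinuousLinearMap.ext fun v => ?_)
  refine (primitive_left_right _).trans ?_
  rw [InnerProductSpace.toDual_apply_apply, L2.inner_def]
  refine integral_congr_ae ?_
  filter_upwards [coeFn_applyLp 1 ((hP.toSystem h0).hamiltonianAlong x (monomialsLp u)) (q' v),
    hq'v v, hP.coeFn_costGradient h0 u (hP.stateCurve h0 x u) (hP.adjointCurve h0 x u),
    ae_restrict_mem measurableSet_Icc] with s hH hv hgrad hs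
  rw [hgrad, ← hP.hamiltonian_monomialsDeriv h0 (Icc_subset_Icc_left h0 hs)]
  refine hH.trans ?_
  rw [hv, stateCurve, adjointCurve, extend_of_mem _ hs, extend_of_mem _ hs, extend_of_mem _ hs,
    ControlSystem.hamiltonianAlong_apply]

end Differentiability

end IsRegular

end AQProblem

open CurveSpace in
theorem proposition4p1_general {n m : ℕ} (P : AQProblem n m) (hP : P.IsRegular)
    (t : ℝ) (ht : t ∈ Icc 0 P.T) (x : Rn n) (u : Control m t P.T) :
    ∃ X Y : ℝ → Rn n,
      P.IsStateAdjoint t x u X Y ∧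
      (∀ X' Y' : ℝ → Rn n, P.IsStateAdjoint t x u X' Y' →
        EqOn X' X (Icc t P.T) ∧ EqOn Y' Y (Icc t P.T)) ∧
      IntervalIntegrable (P.runningCost u X) volume t P.T ∧
      DifferentiableAt ℝ (P.J t x) u ∧
      (∀ᵐ s ∂volume.restrict (Icc t P.T),
        P.DuJ t x u s = P.R s (X s) (u s) + P.S s (X s) + ((P.B s (X s))†) (Y s)) ∧
      DifferentiableAt ℝ (P.DuJ t x) u ∧
      ∀ v : Control m t P.T, ∃ X₁ Y₁ : ℝ → Rn n,
        P.IsLinearized t u X Y v X₁ Y₁ ∧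
        (∀ X₁' Y₁' : ℝ → Rn n, P.IsLinearized t u X Y v X₁' Y₁' →
          EqOn X₁' X₁ (Icc t P.T) ∧ EqOn Y₁' Y₁ (Icc t P.T)) ∧
        ∀ᵐ s ∂volume.restrict (Icc t P.T),
          P.DuuJ t x u v s = P.R s (X s) (v s) + ((P.B s (X s))†) (Y₁ s)
            + P.coefC u X Y s (X₁ s) := by
  have : Fact (t ≤ P.T) := ⟨ht.2⟩
  have hDuJ : P.DuJ t x = fun w =>
      hP.costGradient ht.1 w (hP.stateCurve ht.1 x w) (hP.adjointCurve ht.1 x w) :=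
    funext fun w => (hP.hasGradientAt_J ht.1 x w).gradient
  have hsystem := hP.isStateAdjoint_iff ht.1 x u
  obtain ⟨X', Y', hX', hY', hlinearized⟩ :=
    hP.exists_hasStrictFDerivAt_stateCurve_adjointCurve ht.1 x u
  obtain ⟨D, hD, hDv⟩ := hP.exists_hasFDerivAt_costGradient ht.1 x u hX' hY'
  rw [← hDuJ] at hD
  refine ⟨extend (hP.stateCurve ht.1 x u), extend (hP.adjointCurve ht.1 x u),
    (hsystem _ _).2 ⟨eqOn_refl _ _, eqOn_refl _ _⟩, fun X Y => (hsystem X Y).1,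
    hP.intervalIntegrable_runningCost ht.1 u _,
    (hP.hasGradientAt_J ht.1 x u).differentiableAt, ?_, hD.differentiableAt,
    fun v => ⟨extend (X' v), extend (Y' v), (hlinearized v _ _).2 ⟨eqOn_refl _ _, eqOn_refl _ _⟩,
      fun X₁ Y₁ => (hlinearized v X₁ Y₁).1, ?_⟩⟩
  · rw [hDuJ]
    exact hP.coeFn_costGradient ht.1 u _ _
  · rw [AQProblem.DuuJ, hD.fderiv, hDv]
    exact hP.coeFn_costGradientDeriv ht.1 u _ _ v _ _

theorem proposition4p1 {n m : ℕ} (P : AQProblem n m) (hT : 0 < P.T)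
    (h1 : P.H1) (h2 : P.H2) (h3 : P.H3)
    (t : ℝ) (ht : t ∈ Icc 0 P.T) (x : Rn n) (u : Control m t P.T) :
    ∃ X Y : ℝ → Rn n,
      P.IsStateAdjoint t x u X Y ∧
      (∀ X' Y' : ℝ → Rn n, P.IsStateAdjoint t x u X' Y' →
        EqOn X' X (Icc t P.T) ∧ EqOn Y' Y (Icc t P.T)) ∧
      IntervalIntegrable (P.runningCost u X) volume t P.T ∧
      DifferentiableAt ℝ (P.J t x) u ∧
      (∀ᵐ s ∂volume.restrict (Icc t P.T),
        P.DuJ t x u s = P.R s (X s) (u s) + P.S s (X s) + ((P.B s (X s))†) (Y s)) ∧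
      DifferentiableAt ℝ (P.DuJ t x) u ∧
      ∀ v : Control m t P.T, ∃ X₁ Y₁ : ℝ → Rn n,
        P.IsLinearized t u X Y v X₁ Y₁ ∧
        (∀ X₁' Y₁' : ℝ → Rn n, P.IsLinearized t u X Y v X₁' Y₁' →
          EqOn X₁' X₁ (Icc t P.T) ∧ EqOn Y₁' Y₁ (Icc t P.T)) ∧
        ∀ᵐ s ∂volume.restrict (Icc t P.T),
          P.DuuJ t x u v s = P.R s (X s) (v s) + ((P.B s (X s))†) (Y₁ s)
            + P.coefC u X Y s (X₁ s) :=
  proposition4p1_general P ⟨h3, hT, h1.lipA.imp fun _ h => h.2, h1.lipB.imp fun _ h => h.2,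
    h2.symmR⟩ t ht x u
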